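/- A constrained long-legged $\overline{\sf L}$ is a subset of the Euclidean plane consisting of two perpendicular closed rays that emanate from a common point (its center); equivalently, it is any image of $\{y=0,\ x\ge 0\}\cup\{x=0,\ y\ge 0\}$ under a similarity of the plane (a bijection that multiplies all distances by a positive constant). The regions of a drawing of $n$ such figures are the connected components of the complement of their union in the plane. (i) Two $\overline{\sf L}$'s that have only finitely many points in common meet in at most $3$ points, and $3$ is attained. (ii) For every integer $n\ge 0$, the maximum number of regions into which $n$ $\overline{\sf L}$'s (in arbitrary position) can divide the plane is $$3\binom n2+n+1=\frac{3n^2-n+2}{2}.$$ (iii) The maximum is attained by the following construction. Let $P_0,P_1,\dots,P_{4n-1}$ be $4n$ equally spaced points, in cyclic order, on any circle of positive radius. For $i=0,\dots,n-1$ take the two rays from $P_i$ through $P_{i+n}$ and through $P_{i+3n}$, that is, the corner at $P_i$ of the square $P_iP_{i+n}P_{i+2n}P_{i+3n}$ with its two sides extended to rays. These are $n$ $\overline{\sf L}$'s, and they divide the plane into exactly $(3n^2-n+2)/2$ regions. -/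

import Mathlib

/-- The Euclidean plane. -/
abbrev Plane : Type := EuclideanSpace ℝ (Fin 2)

/-- The closed ray (half-line) that starts at `p` and passes through `q`. -/
def rayFrom (p q : Plane) : Set Plane :=
  {x | ∃ t : ℝ, 0 ≤ t ∧ x = p + t • (q - p)}

/-- The standard constrained long-legged L: the union of the rays
`{y = 0, x ≥ 0}` and `{x = 0, y ≥ 0}`. -/
def standardL : Set Plane :=
  {p | p 1 = 0 ∧ 0 ≤ p 0} ∪ {p | p 0 = 0 ∧ 0 ≤ p 1}

/-- A constrained long-legged L: an image of the standard one under a similarity of the plane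
(`≃ᵈ` is Mathlib's type of bijections that multiply all distances by a positive constant). -/
def IsConstrainedL (S : Set Plane) : Prop :=
  ∃ g : Plane ≃ᵈ Plane, S = g '' standardL

/-- The number of regions into which the sets `S i` divide the plane: the number of connected
components of the complement of their union (`⊤` if there are infinitely many). -/
noncomputable def regionCount {ι : Type*} (S : ι → Set Plane) : ℕ∞ :=
  ENat.card (ConnectedComponents ((⋃ i, S i)ᶜ : Set Plane))

/-- The `k`-th of `4 * n` equally spaced points on the circle with centre `O` and radius `r`;
the point with index `0` is at angle `α`. -/
noncomputable def circlePoint (O : Plane) (r α : ℝ) (n k : ℕ) : Plane :=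
  O + r • !₂[Real.cos (α + 2 * Real.pi * k / (4 * n)), Real.sin (α + 2 * Real.pi * k / (4 * n))]

/-- The corner at `P i` of the square with vertices `P i`, `P (i + n)`, `P (i + 2 * n)`,
`P (i + 3 * n)`, with its two sides extended to rays; here `P k = circlePoint O r α n k`. -/
noncomputable def squareCorner (O : Plane) (r α : ℝ) (n i : ℕ) : Set Plane :=
  rayFrom (circlePoint O r α n i) (circlePoint O r α n (i + n)) ∪
    rayFrom (circlePoint O r α n i) (circlePoint O r α n (i + 3 * n))

/-- The constrained long-legged L's are exactly the unions of two perpendicular rays from a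
common point. -/
theorem isConstrainedL_iff (S : Set Plane) :
    IsConstrainedL S ↔ ∃ c p q : Plane, p ≠ c ∧ q ≠ c ∧ inner ℝ (p - c) (q - c) = 0 ∧
      S = rayFrom c p ∪ rayFrom c q := by
  have hstd : standardL = rayFrom 0 !₂[1, 0] ∪ rayFrom 0 !₂[0, 1] := by
    ext x
    simp only [standardL, rayFrom, Set.mem_union, Set.mem_ofPred_eq, sub_zero, zero_add]
    refine or_congr ⟨fun h => ⟨x 0, h.2, ?_⟩, ?_⟩ ⟨fun h => ⟨x 1, h.2, ?_⟩, ?_⟩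
    · ext i; fin_cases i <;> simp [h.1]
    · rintro ⟨t, ht, rfl⟩; simpa using ht
    · ext i; fin_cases i <;> simp [h.1]
    · rintro ⟨t, ht, rfl⟩; simpa using ht
  have hray : ∀ (r : ℝ) (f : Plane → Plane) (L : Plane →ₗ[ℝ] Plane) (c p q : Plane), 0 < r →
      (∀ x, f x = c + r • L x) → q - c = L p → f '' rayFrom 0 p = rayFrom c q := by
    intro r f L c p q hr hf hq
    ext y
    simp only [rayFrom, Set.mem_image, Set.mem_ofPred_eq, sub_zero, zero_add, hq]
    constructor
    · rintro ⟨x, ⟨t, ht, rfl⟩, rfl⟩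
      exact ⟨r * t, by positivity, by rw [hf, map_smul, smul_smul]⟩
    · rintro ⟨t, ht, rfl⟩
      refine ⟨(r⁻¹ * t) • p, ⟨r⁻¹ * t, by positivity, rfl⟩, ?_⟩
      rw [hf, map_smul, smul_smul, mul_inv_cancel_left₀ hr.ne']
  constructor
  · rintro ⟨g, rfl⟩
    have hr : (0 : ℝ) < Dilation.ratio g := NNReal.coe_pos.2 (Dilation.ratio_pos g)
    have hiso : Isometry (fun x => (Dilation.ratio g : ℝ)⁻¹ • g x) := by
      refine Isometry.of_dist_eq fun x y => ?_
      rw [dist_smul₀, Dilation.dist_eq, Real.norm_of_nonneg (by positivity),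
        inv_mul_cancel_left₀ hr.ne']
    let A := hiso.affineIsometryOfStrictConvexSpace
    let L := A.linearIsometry
    have hg : ∀ x, g x = g 0 + (Dilation.ratio g : ℝ) • L.toLinearMap x := by
      intro x
      have h1 : A x = L x + A 0 := by
        simpa using A.map_vadd 0 x
      have h2 : ∀ x, A x = (Dilation.ratio g : ℝ)⁻¹ • g x := fun x => rfl
      rw [h2, h2] at h1
      have h3 := congrArg (fun z => (Dilation.ratio g : ℝ) • z) h1
      simp only [smul_add, smul_inv_smul₀ hr.ne'] at h3
      rw [h3, add_comm]; rfl
    refine ⟨g 0, g 0 + L !₂[1, 0], g 0 + L !₂[0, 1], ?_, ?_, ?_, ?_⟩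
    · intro h
      have h' := congrArg norm (add_eq_left.1 h)
      simp [EuclideanSpace.norm_eq] at h'
    · intro h
      have h' := congrArg norm (add_eq_left.1 h)
      simp [EuclideanSpace.norm_eq] at h'
    · rw [add_sub_cancel_left, add_sub_cancel_left, L.inner_map_map]
      simp [PiLp.inner_apply]
    · rw [hstd, Set.image_union]
      congr 1
      · exact hray _ _ _ _ _ _ hr hg (by simp)
      · exact hray _ _ _ _ _ _ hr hg (by simp)
  · rintro ⟨c, p, q, hp, hq, hpq, rfl⟩
    have hp' : 0 < ‖p - c‖ := norm_pos_iff.2 (sub_ne_zero.2 hp)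
    have hq' : 0 < ‖q - c‖ := norm_pos_iff.2 (sub_ne_zero.2 hq)
    have hon : Orthonormal ℝ ![‖p - c‖⁻¹ • (p - c), ‖q - c‖⁻¹ • (q - c)] := by
      have hqp : inner ℝ (q - c) (p - c) = 0 := by rw [real_inner_comm]; exact hpq
      refine ⟨fun i => ?_, fun i j hij => ?_⟩
      · fin_cases i
        · simpa [norm_smul] using inv_mul_cancel₀ hp'.ne'
        · simpa [norm_smul] using inv_mul_cancel₀ hq'.ne'
      · fin_cases i <;> fin_cases j <;>
          simp_all [inner_smul_left, inner_smul_right]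
    let b : OrthonormalBasis (Fin 2) ℝ Plane :=
      (basisOfOrthonormalOfCardEqFinrank hon (by simp)).toOrthonormalBasis (by simpa using hon)
    have hb0 : b 0 = ‖p - c‖⁻¹ • (p - c) := by simp [b]
    have hb1 : b 1 = ‖q - c‖⁻¹ • (q - c) := by simp [b]
    let e : Plane ≃ₗᵢ[ℝ] Plane := b.repr.symm
    let g : Plane ≃ᵢ Plane := e.toIsometryEquiv.trans (IsometryEquiv.addLeft c)
    have hg : ∀ x, g x = c + (1 : ℝ) • e.toLinearEquiv.toLinearMap x := fun x => by
      simp [g]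
    have he0 : e !₂[1, 0] = b 0 := by
      have : (!₂[1, 0] : Plane) = EuclideanSpace.single 0 1 := by
        ext i; fin_cases i <;> simp
      rw [this]; exact b.repr_symm_single 0
    have he1 : e !₂[0, 1] = b 1 := by
      have : (!₂[0, 1] : Plane) = EuclideanSpace.single 1 1 := by
        ext i; fin_cases i <;> simp
      rw [this]; exact b.repr_symm_single 1
    have hscale : ∀ a z : Plane, z ≠ a → rayFrom a (a + ‖z - a‖⁻¹ • (z - a)) = rayFrom a z := by
      intro a z hz
      have hz' : 0 < ‖z - a‖ := norm_pos_iff.2 (sub_ne_zero.2 hz)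
      ext y
      simp only [rayFrom, Set.mem_ofPred_eq, add_sub_cancel_left, smul_smul]
      constructor
      · rintro ⟨t, ht, rfl⟩
        exact ⟨t * ‖z - a‖⁻¹, by positivity, rfl⟩
      · rintro ⟨t, ht, rfl⟩
        refine ⟨t * ‖z - a‖, by positivity, ?_⟩
        rw [mul_assoc, mul_inv_cancel₀ hz'.ne', mul_one]
    refine ⟨g.toDilationEquiv, ?_⟩
    rw [hstd, Set.image_union]
    congr 1
    · rw [← hscale c p hp]
      exact (hray 1 g _ c _ _ one_pos hg (by simp [he0, hb0])).symm
    · rw [← hscale c q hq]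
      exact (hray 1 g _ c _ _ one_pos hg (by simp [he1, hb1])).symm

/-! Regions are counted by linear algebra. The locally constant real functions on an open set of the
plane (extended by zero) form a space `locConst` whose dimension is the number of components, so
upper bounds on regions become rank bounds and lower bounds become linear independence.

Upper bound. A homeomorphism of the plane turns any L into a horizontal axis. Another L meets it in
at most three intervals (`IsConstrainedL.exists_three_ordConnected`). Two rays and two arms give
four convex pieces, but perpendicularity forbids four separate ones: if both rays meet both arms,
one ray passes through the corner and its two pieces merge. When the intersection is finite the
intervals are points, which is (i). In general, `n` L's leave at most `3 * n + 1` intervals of the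
new one. The jump across it is constant on each of these, and a function without jumps extends
across, so the rank grows by at most `3 * n + 1` (`rank_locConst_diff_axis_le`). Summation gives the
bound, overlaps and multiple crossings included.

Lower bound. The sides of the squares lie on `2 * n` lines tangent to one circle, and each L is made
of two perpendicular tangents cut off at each other. Two tangents whose indices differ by at most
`n` cross on the drawing, and beyond the crossing both half-lines belong to it, so they bound a
sector. Its indicator is locally constant off the drawing. The mixed second difference at the
crossing is nonzero for this indicator and zero for every other one and for the constant, so all are
independent (`card_corners_lt_connectedComponents`). There are `3 * n.choose 2 + n` such pairs, and
the constant function supplies one more region. -/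

/-! ### Locally constant functions and connected components -/

/-- A function that is locally constant along a preconnected set is constant on it. -/
theorem IsPreconnected.eq_of_eventually_eq {X Y : Type*} [TopologicalSpace X] {s : Set X}
    (hs : IsPreconnected s) {f : X → Y} (hf : ∀ x ∈ s, ∀ᶠ y in nhdsWithin x s, f y = f x)
    {x y : X} (hx : x ∈ s) (hy : y ∈ s) : f x = f y := by
  let _ : TopologicalSpace Y := ⊥
  have : DiscreteTopology Y := ⟨rfl⟩
  refine hs.constant (f := f) (fun z hz => ?_) hx hy
  rw [ContinuousWithinAt, nhds_discrete, Filter.tendsto_pure]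
  exact hf z hz

/-- The real functions that are locally constant at every point of `S` and vanish off `S`. -/
def locConst {X : Type*} [TopologicalSpace X] (S : Set X) : Submodule ℝ (X → ℝ) where
  carrier := {f | (∀ x ∈ S, ∀ᶠ y in nhds x, f y = f x) ∧ ∀ x ∉ S, f x = 0}
  zero_mem' := ⟨fun _ _ => by simp, fun _ _ => rfl⟩
  add_mem' := by
    rintro f g ⟨hf, hf'⟩ ⟨hg, hg'⟩
    refine ⟨fun x hx => ?_, fun x hx => by simp [hf' x hx, hg' x hx]⟩
    filter_upwards [hf x hx, hg x hx] with y h1 h2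
    simp [h1, h2]
  smul_mem' := by
    rintro c f ⟨hf, hf'⟩
    refine ⟨fun x hx => ?_, fun x hx => by simp [hf' x hx]⟩
    filter_upwards [hf x hx] with y h1
    simp [h1]

section locConst

variable {X : Type*} [TopologicalSpace X]

theorem mem_locConst {S : Set X} {f : X → ℝ} :
    f ∈ locConst S ↔ (∀ x ∈ S, ∀ᶠ y in nhds x, f y = f x) ∧ ∀ x ∉ S, f x = 0 := Iff.rfl

theorem eq_of_mem_locConst {S T : Set X} {f : X → ℝ} (hf : f ∈ locConst S)
    (hT : IsPreconnected T) (hTS : T ⊆ S) {x y : X} (hx : x ∈ T) (hy : y ∈ T) : f x = f y :=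
  hT.eq_of_eventually_eq (fun z hz => (hf.1 z (hTS hz)).filter_mono nhdsWithin_le_nhds) hx hy

/-- Linearly independent elements of `locConst S` are at most as many as the components. -/
theorem card_le_connectedComponents {S : Set X} {ι : Type*} [Fintype ι] {v : ι → locConst S}
    (hv : LinearIndependent ℝ v) : (Fintype.card ι : ℕ∞) ≤ ENat.card (ConnectedComponents S) := by
  classical
  rcases finite_or_infinite (ConnectedComponents S) with h | h
  · have := Fintype.ofFinite (ConnectedComponents S)
    let σ : ConnectedComponents S → S := Function.surjInv ConnectedComponents.surjective_coe
    have hσ : ∀ c, (σ c : ConnectedComponents S) = c :=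
      Function.surjInv_eq ConnectedComponents.surjective_coe
    -- One value per component determines the function, so evaluation at the representatives `σ c`
    -- is injective.
    let φ : locConst S →ₗ[ℝ] (ConnectedComponents S → ℝ) :=
      { toFun := fun f c => f.1 (σ c)
        map_add' := fun _ _ => rfl
        map_smul' := fun _ _ => rfl }
    have hφ : LinearMap.ker φ = ⊥ := by
      rw [LinearMap.ker_eq_bot']
      intro f hf
      ext x
      by_cases hx : x ∈ S
      · have h1 : f.1 x = f.1 (σ (⟨x, hx⟩ : S)) := by
          have h2 : (σ ((⟨x, hx⟩ : S) : ConnectedComponents S)) ∈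
              connectedComponent (⟨x, hx⟩ : S) :=
            ConnectedComponents.coe_eq_coe'.1 (hσ _)
          refine eq_of_mem_locConst f.2
            (T := Subtype.val '' connectedComponent (⟨x, hx⟩ : S))
            (isPreconnected_connectedComponent.image _ continuous_subtype_val.continuousOn) ?_
            ⟨_, mem_connectedComponent, rfl⟩ ⟨_, h2, rfl⟩
          rintro _ ⟨z, -, rfl⟩
          exact z.2
        rw [h1]
        exact congrFun hf _
      · exact f.2.2 x hx
    have h3 := (hv.map' φ hφ).fintype_card_le_finrank
    rw [Module.finrank_fintype_fun_eq_card] at h3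
    rw [ENat.card_eq_coe_fintype_card]
    exact_mod_cast h3
  · simp

/-- The number of components of an open set is bounded by the rank of `locConst`. -/
theorem connectedComponents_le_of_rank_le [LocallyConnectedSpace X] {S : Set X} (hS : IsOpen S)
    {N : ℕ} (h : Module.rank ℝ (locConst S) ≤ N) :
    ENat.card (ConnectedComponents S) ≤ N := by
  classical
  have : LocallyConnectedSpace S := hS.isOpenEmbedding_subtypeVal.locallyConnectedSpace
  -- Indicators of components: locally constant because components of an open set are open here, and
  -- independent because each is nonzero on its own component only.
  let v : ConnectedComponents S → locConst S := fun c =>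
    ⟨fun x => if hx : x ∈ S then (if ((⟨x, hx⟩ : S) : ConnectedComponents S) = c then 1 else 0)
      else 0, by
      refine ⟨fun x hx => ?_, fun x hx => by simp [hx]⟩
      have h1 : IsOpen (Subtype.val '' connectedComponent (⟨x, hx⟩ : S)) :=
        hS.isOpenMap_subtype_val _ isOpen_connectedComponent
      filter_upwards [h1.mem_nhds ⟨_, mem_connectedComponent, rfl⟩]
      rintro _ ⟨z, hz, rfl⟩
      have h2 : (z : ConnectedComponents S) = ((⟨x, hx⟩ : S) : ConnectedComponents S) :=
        ConnectedComponents.coe_eq_coe'.2 hz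
      simp [hx, h2]⟩
  have hv : LinearIndependent ℝ v := by
    rw [linearIndependent_iff']
    intro s g hg c hc
    obtain ⟨x, rfl⟩ := ConnectedComponents.surjective_coe c
    have h1 := congrArg (fun f : locConst S => f.1 x) hg
    simpa [v, hc] using h1
  have h1 := hv.cardinal_le_rank.trans h
  have h2 := (Cardinal.toENat.monotone' h1)
  simpa [ENat.card] using h2

/-- Restriction of a locally constant function to the set left after removing a closed set. -/
noncomputable def locConstRestrict (U A : Set X) (hA : IsClosed A) :
    locConst U →ₗ[ℝ] locConst (U \ A) where
  toFun f := ⟨(U \ A).indicator f.1, by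
    refine mem_locConst.2 ⟨fun x hx => ?_, fun x hx => by simp [hx]⟩
    filter_upwards [f.2.1 x hx.1, hA.isOpen_compl.mem_nhds hx.2] with y hy hyA
    rw [Set.indicator_of_mem hx]
    by_cases hyU : y ∈ U
    · rw [Set.indicator_of_mem (show y ∈ U \ A from ⟨hyU, hyA⟩), hy]
    · rw [Set.indicator_of_notMem (fun h => hyU h.1), ← hy, f.2.2 y hyU]⟩
  map_add' f g := by
    ext x
    by_cases hx : x ∈ U \ A <;> simp [Set.indicator, hx]
  map_smul' c f := by
    ext x
    by_cases hx : x ∈ U \ A <;> simp [Set.indicator, hx]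

theorem comp_mem_locConst {Y : Type*} [TopologicalSpace Y] {e : X → Y} (he : Continuous e)
    {S : Set Y} {f : Y → ℝ} (hf : f ∈ locConst S) : f ∘ e ∈ locConst (e ⁻¹' S) :=
  ⟨fun x hx => he.continuousAt.eventually (hf.1 (e x) hx), fun x hx => hf.2 (e x) hx⟩

/-- A homeomorphism transports locally constant functions. -/
noncomputable def locConstCongr {Y : Type*} [TopologicalSpace Y] (e : X ≃ₜ Y) (S : Set Y) :
    locConst S ≃ₗ[ℝ] locConst (e ⁻¹' S) where
  toFun f := ⟨f.1 ∘ e, comp_mem_locConst e.continuous f.2⟩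
  invFun f := ⟨f.1 ∘ e.symm, by
    have h := comp_mem_locConst e.symm.continuous f.2
    rwa [← Set.preimage_comp, e.self_comp_symm, Set.preimage_id] at h⟩
  map_add' _ _ := rfl
  map_smul' _ _ := rfl
  left_inv f := by ext x; simp
  right_inv f := by ext x; simp

end locConst

/-! ### Removing a line: the jump map -/

/-- Removing a horizontal line, which meets the open set `U` in at most `m` segments, from `U`
raises the rank of the space of locally constant functions by at most `m`. -/
theorem rank_locConst_diff_axis_le {U : Set (ℝ × ℝ)} (hU : IsOpen U) {m : ℕ} (σ : ℝ → Fin m)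
    (hσ : ∀ x y, (x, (0 : ℝ)) ∈ U → (y, (0 : ℝ)) ∈ U → σ x = σ y →
      ∀ z ∈ Set.uIcc x y, (z, (0 : ℝ)) ∈ U) :
    Module.rank ℝ (locConst (U \ {p | p.2 = 0})) ≤ Module.rank ℝ (locConst U) + m := by
  classical
  have hA : IsClosed {p : ℝ × ℝ | p.2 = 0} := isClosed_eq continuous_snd continuous_const
  have hbox : ∀ x : ℝ, ∃ δ : ℝ, 0 < δ ∧ ((x, (0 : ℝ)) ∈ U →
      Set.Ioo (x - δ) (x + δ) ×ˢ Set.Ioo (-δ) δ ⊆ U) := by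
    intro x
    by_cases hx : (x, (0 : ℝ)) ∈ U
    · obtain ⟨δ, hδ, h⟩ := Metric.isOpen_iff.1 hU _ hx
      refine ⟨δ, hδ, fun _ => ?_⟩
      rwa [← ball_prod_same, Real.ball_eq_Ioo, Real.ball_eq_Ioo, zero_sub, zero_add] at h
    · exact ⟨1, one_pos, fun h => absurd h hx⟩
  choose δ hδ hδU using hbox
  -- the values of `f` next to the axis
  have hup : ∀ f ∈ locConst (U \ {p : ℝ × ℝ | p.2 = 0}), ∀ x, (x, (0 : ℝ)) ∈ U →
      ∀ y ∈ Set.Ioo (x - δ x) (x + δ x), ∀ t ∈ Set.Ioo 0 (δ x), f (y, t) = f (x, δ x / 2) := by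
    intro f hf x hx y hy t ht
    have hd := hδ x
    refine eq_of_mem_locConst hf
      (T := Set.Ioo (x - δ x) (x + δ x) ×ˢ Set.Ioo 0 (δ x))
      (isPreconnected_Ioo.prod isPreconnected_Ioo) ?_ ⟨hy, ht⟩
      ⟨⟨by simp only; linarith, by simp only; linarith⟩,
        ⟨by simp only; linarith, by simp only; linarith⟩⟩
    rintro ⟨a, b⟩ ⟨ha, hb⟩
    exact ⟨hδU x hx ⟨ha, ⟨by linarith [hb.1], hb.2⟩⟩, hb.1.ne'⟩
  have hdown : ∀ f ∈ locConst (U \ {p : ℝ × ℝ | p.2 = 0}), ∀ x, (x, (0 : ℝ)) ∈ U →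
      ∀ y ∈ Set.Ioo (x - δ x) (x + δ x), ∀ t ∈ Set.Ioo (-δ x) 0,
        f (y, t) = f (x, -(δ x / 2)) := by
    intro f hf x hx y hy t ht
    have hd := hδ x
    refine eq_of_mem_locConst hf
      (T := Set.Ioo (x - δ x) (x + δ x) ×ˢ Set.Ioo (-δ x) 0)
      (isPreconnected_Ioo.prod isPreconnected_Ioo) ?_ ⟨hy, ht⟩
      ⟨⟨by simp only; linarith, by simp only; linarith⟩,
        ⟨by simp only; linarith, by simp only; linarith⟩⟩
    rintro ⟨a, b⟩ ⟨ha, hb⟩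
    exact ⟨hδU x hx ⟨ha, ⟨hb.1, by linarith [hb.2]⟩⟩, hb.2.ne⟩
  have hup' : ∀ f ∈ locConst (U \ {p : ℝ × ℝ | p.2 = 0}), ∀ x, (x, (0 : ℝ)) ∈ U →
      ∀ y ∈ Set.Ioo (x - δ x) (x + δ x), (y, (0 : ℝ)) ∈ U →
        f (y, δ y / 2) = f (x, δ x / 2) := by
    intro f hf x hx y hy hyU
    have h1 := hδ x
    have h2 := hδ y
    have h3 : 0 < min (δ x) (δ y) := lt_min h1 h2
    have h4 := min_le_left (δ x) (δ y)
    have h5 := min_le_right (δ x) (δ y)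
    rw [← hup f hf x hx y hy (min (δ x) (δ y) / 2) ⟨by linarith, by linarith⟩,
      ← hup f hf y hyU y ⟨by linarith, by linarith⟩ (min (δ x) (δ y) / 2)
        ⟨by linarith, by linarith⟩]
  have hdown' : ∀ f ∈ locConst (U \ {p : ℝ × ℝ | p.2 = 0}), ∀ x, (x, (0 : ℝ)) ∈ U →
      ∀ y ∈ Set.Ioo (x - δ x) (x + δ x), (y, (0 : ℝ)) ∈ U →
        f (y, -(δ y / 2)) = f (x, -(δ x / 2)) := by
    intro f hf x hx y hy hyU
    have h1 := hδ x
    have h2 := hδ y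
    have h3 : 0 < min (δ x) (δ y) := lt_min h1 h2
    have h4 := min_le_left (δ x) (δ y)
    have h5 := min_le_right (δ x) (δ y)
    rw [← hdown f hf x hx y hy (-(min (δ x) (δ y) / 2)) ⟨by linarith, by linarith⟩,
      ← hdown f hf y hyU y ⟨by linarith, by linarith⟩ (-(min (δ x) (δ y) / 2))
        ⟨by linarith, by linarith⟩]
  -- One axis point of `U` per label. The default 0 for unused labels is harmless: a vanishing jump
  -- is exploited only at labels that occur.
  let rep : Fin m → ℝ := fun s =>
    if h : ∃ x, (x, (0 : ℝ)) ∈ U ∧ σ x = s then h.choose else 0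
  have hrep : ∀ x, (x, (0 : ℝ)) ∈ U →
      (rep (σ x), (0 : ℝ)) ∈ U ∧ σ (rep (σ x)) = σ x := by
    intro x hx
    have h : ∃ x', (x', (0 : ℝ)) ∈ U ∧ σ x' = σ x := ⟨x, hx, rfl⟩
    simp only [rep, dif_pos h]
    exact h.choose_spec
  let jump : locConst (U \ {p : ℝ × ℝ | p.2 = 0}) →ₗ[ℝ] (Fin m → ℝ) :=
    { toFun := fun f s => f.1 (rep s, δ (rep s) / 2) - f.1 (rep s, -(δ (rep s) / 2))
      map_add' := fun f g => by ext s; simp; ring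
      map_smul' := fun c f => by ext s; simp; ring }
  -- The jump is locally constant along the axis inside `U`, hence constant between points with the
  -- same label. If it vanishes at the representatives it vanishes everywhere, and `f` extends over
  -- the axis.
  have hker : LinearMap.ker jump ≤ LinearMap.range (locConstRestrict U _ hA) := by
    intro f hf
    have hzero : ∀ x, (x, (0 : ℝ)) ∈ U → f.1 (x, δ x / 2) = f.1 (x, -(δ x / 2)) := by
      intro x hx
      obtain ⟨hr, hrσ⟩ := hrep x hx
      have h1 : f.1 (rep (σ x), δ (rep (σ x)) / 2) - f.1 (rep (σ x), -(δ (rep (σ x)) / 2)) = 0 :=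
        congrFun hf (σ x)
      have h2 := hσ x _ hx hr hrσ.symm
      have h3 := (isPreconnected_uIcc (a := x) (b := rep (σ x))).eq_of_eventually_eq
        (f := fun z => f.1 (z, δ z / 2) - f.1 (z, -(δ z / 2))) (fun z hz => by
          have hd := hδ z
          filter_upwards [self_mem_nhdsWithin, nhdsWithin_le_nhds
            (Ioo_mem_nhds (a := z - δ z) (b := z + δ z) (by linarith) (by linarith))]
            with y hy hyz
          rw [hup' f.1 f.2 z (h2 z hz) y hyz (h2 y hy),
            hdown' f.1 f.2 z (h2 z hz) y hyz (h2 y hy)])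
        Set.left_mem_uIcc Set.right_mem_uIcc
      linarith
    -- On the axis the extension takes the value found just above it, which equals the one just
    -- below.
    let g : ℝ × ℝ → ℝ := fun p =>
      if p.2 = 0 ∧ p ∈ U then f.1 (p.1, δ p.1 / 2) else f.1 p
    have hg : g ∈ locConst U := by
      refine ⟨?_, fun p hp => ?_⟩
      · rintro ⟨x, y⟩ hp
        by_cases hy : y = 0
        · subst hy
          have hd := hδ x
          have hgx : g (x, 0) = f.1 (x, δ x / 2) := if_pos ⟨rfl, hp⟩
          have hnear : Set.Ioo (x - δ x) (x + δ x) ×ˢ Set.Ioo (-δ x) (δ x) ∈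
              nhds (x, (0 : ℝ)) :=
            prod_mem_nhds (Ioo_mem_nhds (by linarith) (by linarith))
              (Ioo_mem_nhds (by linarith) hd)
          filter_upwards [hnear]
          rintro ⟨a, b⟩ ⟨ha, hb⟩
          simp only at ha hb
          rw [hgx]
          rcases lt_trichotomy b 0 with h | h | h
          · simp only [g, h.ne, false_and, if_false]
            rw [hdown f.1 f.2 x hp a ha b ⟨hb.1, h⟩, hzero x hp]
          · subst h
            have haU : (a, (0 : ℝ)) ∈ U := hδU x hp ⟨ha, hb⟩
            simp only [g, haU, true_and, if_true]
            exact hup' f.1 f.2 x hp a ha haU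
          · simp only [g, h.ne', false_and, if_false]
            exact hup f.1 f.2 x hp a ha b ⟨h, hb.2⟩
        · have h1 : ∀ᶠ q : ℝ × ℝ in nhds (x, y), q.2 ≠ 0 :=
            hA.isOpen_compl.mem_nhds hy
          filter_upwards [h1, f.2.1 (x, y) ⟨hp, hy⟩] with q hq hfq
          simp only [g, hq, hy, false_and, if_false, hfq]
      · simp only [g, hp, and_false, if_false]
        exact f.2.2 p fun h => hp h.1
    refine ⟨⟨g, hg⟩, ?_⟩
    ext p
    change (U \ {p : ℝ × ℝ | p.2 = 0}).indicator g p = f.1 p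
    by_cases hp : p ∈ U \ {p : ℝ × ℝ | p.2 = 0}
    · rw [Set.indicator_of_mem hp]
      exact if_neg fun h => hp.2 h.1
    · rw [Set.indicator_of_notMem hp, f.2.2 p hp]
  rw [← LinearMap.rank_range_add_rank_ker jump, add_comm]
  refine add_le_add ((Submodule.rank_mono hker).trans ?_) ((Submodule.rank_le _).trans ?_)
  · exact rank_range_le _
  · simp

/-! ### How one L meets another -/

theorem convex_rayFrom (p q : Plane) : Convex ℝ (rayFrom p q) := by
  rintro _ ⟨t, ht, rfl⟩ _ ⟨s, hs, rfl⟩ a b ha hb hab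
  refine ⟨a * t + b * s, by positivity, ?_⟩
  obtain rfl : b = 1 - a := by linarith
  module

/-- The boundary parametrisation of the standard L. -/
noncomputable def standardPath (x : ℝ) : Plane := !₂[max x 0, max (-x) 0]

/-- Folding the plane so that the standard L becomes the horizontal axis. -/
noncomputable def unfold : Plane ≃ₜ ℝ × ℝ where
  toFun p := (p 0 - p 1, min (p 0) (p 1))
  invFun q := !₂[q.2 + max q.1 0, q.2 + max (-q.1) 0]
  left_inv p := by
    ext i
    rcases le_total (p 0) (p 1) with h | h <;> fin_cases i <;> simp [h]
  right_inv q := by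
    obtain ⟨a, b⟩ := q
    rcases le_total a 0 with h | h <;> simp [h]
  continuous_toFun := by fun_prop
  continuous_invFun := by fun_prop

theorem unfold_symm_axis (x : ℝ) : unfold.symm (x, 0) = standardPath x := by
  ext i
  fin_cases i <;> simp [unfold, standardPath]

theorem unfold_preimage_axis : unfold ⁻¹' {p | p.2 = 0} = standardL := by
  ext p
  simp only [unfold, standardL, Set.mem_preimage, Homeomorph.homeomorph_mk_coe,
    Equiv.coe_fn_mk, Set.mem_ofPred_eq, Set.mem_union]
  rcases le_total (p 0) (p 1) with h | h
  · rw [min_eq_left h]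
    exact ⟨fun h0 => Or.inr ⟨h0, h0 ▸ h⟩, by rintro (⟨h1, h2⟩ | ⟨h1, h2⟩) <;> linarith⟩
  · rw [min_eq_right h]
    exact ⟨fun h0 => Or.inl ⟨h0, h0 ▸ h⟩, by rintro (⟨h1, h2⟩ | ⟨h1, h2⟩) <;> linarith⟩

theorem range_standardPath : Set.range standardPath = standardL := by
  rw [← unfold_preimage_axis]
  ext p
  constructor
  · rintro ⟨x, rfl⟩
    rw [← unfold_symm_axis]
    simp
  · intro hp
    refine ⟨(unfold p).1, ?_⟩
    rw [← unfold_symm_axis, Homeomorph.symm_apply_eq]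
    exact Prod.ext rfl (Eq.symm hp)

theorem standardPath_injective : Function.Injective standardPath := by
  intro x y h
  rw [← unfold_symm_axis, ← unfold_symm_axis] at h
  exact congrArg Prod.fst (unfold.symm.injective h)

theorem IsConstrainedL.preimage {T : Set Plane} (hT : IsConstrainedL T) (g : Plane ≃ᵈ Plane) :
    IsConstrainedL (g ⁻¹' T) := by
  obtain ⟨f, rfl⟩ := hT
  refine ⟨f.trans g.symm, ?_⟩
  ext x
  constructor
  · rintro ⟨y, hy, h⟩
    exact ⟨y, hy, by simp [h]⟩
  · rintro ⟨y, hy, rfl⟩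
    exact ⟨y, hy, by simp⟩

/-- The path is affine on each arm, though not across the corner, so a convex set pulls back to an
interval on each half-line separately. -/
theorem ordConnected_path_nonneg {R : Set Plane} (hR : Convex ℝ R) :
    Set.OrdConnected {x | 0 ≤ x ∧ standardPath x ∈ R} := by
  refine Convex.ordConnected (𝕜 := ℝ) ?_
  rintro x ⟨hx, hxR⟩ y ⟨hy, hyR⟩ a b ha hb hab
  have h0 : 0 ≤ a • x + b • y := by simp only [smul_eq_mul]; positivity
  refine ⟨h0, ?_⟩
  convert hR hxR hyR ha hb hab using 1
  ext i
  fin_cases i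
  · simp only [smul_eq_mul] at h0
    simp [standardPath, hx, hy, h0]
  · simp only [smul_eq_mul] at h0
    have h1 : -(b * y) + -(a * x) ≤ 0 := by linarith
    simp [standardPath, hx, hy, h1]

theorem ordConnected_path_nonpos {R : Set Plane} (hR : Convex ℝ R) :
    Set.OrdConnected {x | x ≤ 0 ∧ standardPath x ∈ R} := by
  refine Convex.ordConnected (𝕜 := ℝ) ?_
  rintro x ⟨hx, hxR⟩ y ⟨hy, hyR⟩ a b ha hb hab
  have h1 : a • x ≤ 0 := smul_nonpos_of_nonneg_of_nonpos ha hx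
  have h2 : b • y ≤ 0 := smul_nonpos_of_nonneg_of_nonpos hb hy
  have h0 : a • x + b • y ≤ 0 := add_nonpos h1 h2
  refine ⟨h0, ?_⟩
  convert hR hxR hyR ha hb hab using 1
  ext i
  simp only [smul_eq_mul] at h0
  fin_cases i
  · simp [standardPath, hx, hy, h0]
  · have h1 : 0 ≤ -(b * y) + -(a * x) := by linarith
    simp [standardPath, hx, hy, h1]
    ring

theorem Set.OrdConnected.union_of_mem {s t : Set ℝ} (hs : s.OrdConnected) (ht : t.OrdConnected)
    {x : ℝ} (hxs : x ∈ s) (hxt : x ∈ t) : (s ∪ t).OrdConnected :=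
  (IsPreconnected.union x hxs hxt hs.isPreconnected ht.isPreconnected).ordConnected

/-- Two rays in perpendicular directions, each meeting both arms of the standard L: one of them
contains the corner. -/
theorem zero_mem_of_arms {R Q : Set Plane} {c p q : Plane} (hR : R = rayFrom c p)
    (hQ : Q = rayFrom c q) (hpq : inner ℝ (p - c) (q - c) = 0) {a b a' b' : ℝ}
    (ha : 0 ≤ a) (hb : b ≤ 0) (ha' : 0 ≤ a') (hb' : b' ≤ 0) (haR : standardPath a ∈ R)
    (hbR : standardPath b ∈ R) (haQ : standardPath a' ∈ Q) (hbQ : standardPath b' ∈ Q) :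
    standardPath 0 ∈ R ∨ standardPath 0 ∈ Q := by
  -- The chord from `standardPath b` to `standardPath a` is the vector `(a, b)`, and it is parallel
  -- to its ray; likewise `(a', b')`. Both products are nonnegative, so both vanish.
  have hperp : a * a' + b * b' = 0 := by
    rw [hR] at haR hbR
    rw [hQ] at haQ hbQ
    obtain ⟨t, -, ht⟩ := haR
    obtain ⟨s, -, hs⟩ := hbR
    obtain ⟨t', -, ht'⟩ := haQ
    obtain ⟨s', -, hs'⟩ := hbQ
    have h1 : standardPath a - standardPath b = (t - s) • (p - c) := by
      rw [ht, hs]; module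
    have h2 : standardPath a' - standardPath b' = (t' - s') • (q - c) := by
      rw [ht', hs']; module
    have h3 : inner ℝ (standardPath a - standardPath b) (standardPath a' - standardPath b') = 0 := by
      rw [h1, h2, inner_smul_left, inner_smul_right, hpq]; simp
    simp [standardPath, PiLp.inner_apply, ha, hb, ha', hb'] at h3
    linarith
  have h1 : 0 ≤ a * a' := mul_nonneg ha ha'
  have h2 : 0 ≤ b * b' := mul_nonneg_of_nonpos_of_nonpos hb hb'
  have h3 : a * a' = 0 := by linarith
  have h4 : b * b' = 0 := by linarith
  rcases mul_eq_zero.1 h3 with h | h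
  · exact Or.inl (h ▸ haR)
  · exact Or.inr (h ▸ haQ)

/-- An L cuts the standard L in at most three connected pieces. -/
theorem IsConstrainedL.exists_three_ordConnected {T : Set Plane} (hT : IsConstrainedL T) :
    ∃ J : Fin 3 → Set ℝ, (∀ i, (J i).OrdConnected) ∧
      ∀ x, standardPath x ∈ T ↔ ∃ i, x ∈ J i := by
  obtain ⟨c, p, q, -, -, hpq, rfl⟩ := (isConstrainedL_iff T).1 hT
  generalize hR : rayFrom c p = R
  generalize hQ : rayFrom c q = Q
  have hRc : Convex ℝ R := hR ▸ convex_rayFrom c p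
  have hQc : Convex ℝ Q := hQ ▸ convex_rayFrom c q
  have h1 := ordConnected_path_nonneg hRc
  have h2 := ordConnected_path_nonpos hRc
  have h3 := ordConnected_path_nonneg hQc
  have h4 := ordConnected_path_nonpos hQc
  have hmem : ∀ x, standardPath x ∈ R ∪ Q ↔
      x ∈ {x | 0 ≤ x ∧ standardPath x ∈ R} ∨ x ∈ {x | x ≤ 0 ∧ standardPath x ∈ R} ∨
      x ∈ {x | 0 ≤ x ∧ standardPath x ∈ Q} ∨ x ∈ {x | x ≤ 0 ∧ standardPath x ∈ Q} := by
    intro x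
    have := le_total 0 x
    simp only [Set.mem_union, Set.mem_ofPred_eq]
    tauto
  have hzR : standardPath 0 ∈ R → (0 : ℝ) ∈ {x | 0 ≤ x ∧ standardPath x ∈ R} ∧
      (0 : ℝ) ∈ {x | x ≤ 0 ∧ standardPath x ∈ R} := fun h => ⟨⟨le_rfl, h⟩, ⟨le_rfl, h⟩⟩
  have hzQ : standardPath 0 ∈ Q → (0 : ℝ) ∈ {x | 0 ≤ x ∧ standardPath x ∈ Q} ∧
      (0 : ℝ) ∈ {x | x ≤ 0 ∧ standardPath x ∈ Q} := fun h => ⟨⟨le_rfl, h⟩, ⟨le_rfl, h⟩⟩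
  have hz : {x | 0 ≤ x ∧ standardPath x ∈ R}.Nonempty →
      {x | x ≤ 0 ∧ standardPath x ∈ R}.Nonempty → {x | 0 ≤ x ∧ standardPath x ∈ Q}.Nonempty →
      {x | x ≤ 0 ∧ standardPath x ∈ Q}.Nonempty → standardPath 0 ∈ R ∨ standardPath 0 ∈ Q := by
    rintro ⟨a, ha, haR⟩ ⟨b, hb, hbR⟩ ⟨a', ha', haQ⟩ ⟨b', hb', hbQ⟩
    exact zero_mem_of_arms hR.symm hQ.symm hpq ha hb ha' hb' haR hbR haQ hbQ
  generalize {x | 0 ≤ x ∧ standardPath x ∈ R} = A at *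
  generalize {x | x ≤ 0 ∧ standardPath x ∈ R} = B at *
  generalize {x | 0 ≤ x ∧ standardPath x ∈ Q} = C at *
  generalize {x | x ≤ 0 ∧ standardPath x ∈ Q} = D at *
  have build : ∀ A B C : Set ℝ, A.OrdConnected → B.OrdConnected → C.OrdConnected →
      (∀ x, standardPath x ∈ R ∪ Q ↔ x ∈ A ∨ x ∈ B ∨ x ∈ C) →
      ∃ J : Fin 3 → Set ℝ, (∀ i, (J i).OrdConnected) ∧
        ∀ x, standardPath x ∈ R ∪ Q ↔ ∃ i, x ∈ J i := by
    intro A B C hA hB hC h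
    refine ⟨![A, B, C], fun i => by fin_cases i <;> assumption, fun x => ?_⟩
    rw [h, Fin.exists_fin_succ, Fin.exists_fin_two]
    rfl
  -- If a ray contains the corner, its two pieces share the parameter 0 and merge. Otherwise `hz`
  -- forces one of the four pieces to be empty.
  by_cases hR0 : standardPath 0 ∈ R
  · refine build (A ∪ B) C D (h1.union_of_mem h2 (hzR hR0).1 (hzR hR0).2) h3 h4 fun x => ?_
    rw [hmem, Set.mem_union, or_assoc]
  by_cases hQ0 : standardPath 0 ∈ Q
  · refine build A B (C ∪ D) h1 h2 (h3.union_of_mem h4 (hzQ hQ0).1 (hzQ hQ0).2) fun x => ?_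
    rw [hmem, Set.mem_union]
  rcases A.eq_empty_or_nonempty with rfl | hA
  · exact build B C D h2 h3 h4 fun x => by simp [hmem]
  rcases B.eq_empty_or_nonempty with rfl | hB
  · exact build A C D h1 h3 h4 fun x => by simp [hmem]
  rcases C.eq_empty_or_nonempty with rfl | hC
  · exact build A B D h1 h2 h4 fun x => by simp [hmem]
  rcases D.eq_empty_or_nonempty with rfl | hD
  · exact build A B C h1 h2 h3 fun x => by simp [hmem]
  exact ((hz hA hB hC hD).elim hR0 hQ0).elim

theorem Set.OrdConnected.subsingleton_of_finite {s : Set ℝ} (hs : s.OrdConnected)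
    (hf : s.Finite) : s.Subsingleton := by
  intro x hx y hy
  by_contra h
  rcases lt_or_gt_of_ne h with h | h
  · exact Set.Icc_infinite h (hf.subset (hs.out hx hy))
  · exact Set.Icc_infinite h (hf.subset (hs.out hy hx))

/-- Two L's with finite intersection meet in at most three points. -/
theorem IsConstrainedL.ncard_inter_le {S T : Set Plane} (hS : IsConstrainedL S)
    (hT : IsConstrainedL T) (hfin : (S ∩ T).Finite) : (S ∩ T).ncard ≤ 3 := by
  obtain ⟨g, rfl⟩ := hS
  obtain ⟨J, hJ, hmem⟩ := (hT.preimage g).exists_three_ordConnected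
  have hST : g '' standardL ∩ T = (g ∘ standardPath) '' ⋃ i, J i := by
    ext x
    rw [← range_standardPath]
    constructor
    · rintro ⟨⟨_, ⟨y, rfl⟩, rfl⟩, hx⟩
      exact ⟨y, Set.mem_iUnion.2 ((hmem y).1 hx), rfl⟩
    · rintro ⟨y, hy, rfl⟩
      exact ⟨⟨_, ⟨y, rfl⟩, rfl⟩, (hmem y).2 (Set.mem_iUnion.1 hy)⟩
  have hinj : Function.Injective (g ∘ standardPath) := g.injective.comp standardPath_injective
  rw [hST] at hfin ⊢
  rw [Set.ncard_image_of_injective _ hinj]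
  have hfin' := hfin.of_finite_image hinj.injOn
  have h1 : ∀ i, (J i).ncard ≤ 1 := fun i =>
    (Set.ncard_le_one (hfin'.subset (Set.subset_iUnion J i))).2 fun a ha b hb =>
      (hJ i).subsingleton_of_finite (hfin'.subset (Set.subset_iUnion J i)) ha hb
  have h2 : (⋃ i, J i) = J 0 ∪ J 1 ∪ J 2 := by
    ext x
    simp [Fin.exists_fin_succ, or_assoc]
  rw [h2]
  have h3 := Set.ncard_union_le (J 0 ∪ J 1) (J 2)
  have h4 := Set.ncard_union_le (J 0) (J 1)
  have := h1 0
  have := h1 1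
  have := h1 2
  omega

theorem exists_inter_ncard_eq_three : ∃ S T : Set Plane, IsConstrainedL S ∧ IsConstrainedL T ∧
    (S ∩ T).Finite ∧ (S ∩ T).ncard = 3 := by
  -- The directions are the diagonals `(1, -1)` and `(1, 1)`: the first ray crosses both arms, the
  -- second only the vertical one.
  have key : standardL ∩ (rayFrom !₂[-1, 2] !₂[0, 1] ∪ rayFrom !₂[-1, 2] !₂[0, 3]) =
      {!₂[1, 0], !₂[0, 1], !₂[0, 3]} := by
    ext x
    simp only [standardL, rayFrom, Set.mem_inter_iff, Set.mem_union, Set.mem_ofPred_eq,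
      Set.mem_insert_iff, Set.mem_singleton_iff]
    constructor
    · rintro ⟨h, ⟨t, ht, rfl⟩ | ⟨t, ht, rfl⟩⟩
      · simp at h
        rcases h with h | h
        · left
          have : t = 2 := by linarith
          subst this
          ext i; fin_cases i <;> norm_num
        · right; left
          have : t = 1 := by linarith
          subst this
          ext i; fin_cases i <;> norm_num
      · simp at h
        rcases h with h | h
        · exfalso; linarith
        · right; right
          have : t = 1 := by linarith
          subst this
          ext i; fin_cases i <;> norm_num
    · rintro (rfl | rfl | rfl)
      · refine ⟨by simp, Or.inl ⟨2, by norm_num, ?_⟩⟩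
        ext i; fin_cases i <;> norm_num
      · refine ⟨by simp, Or.inl ⟨1, by norm_num, ?_⟩⟩
        ext i; fin_cases i <;> norm_num
      · refine ⟨by simp, Or.inr ⟨1, by norm_num, ?_⟩⟩
        ext i; fin_cases i <;> norm_num
  have hne : ∀ a b c d : ℝ, (!₂[a, b] : Plane) = !₂[c, d] → a = c ∧ b = d := fun a b c d h =>
    ⟨by simpa using congrFun (congrArg WithLp.ofLp h) 0,
      by simpa using congrFun (congrArg WithLp.ofLp h) 1⟩
  refine ⟨standardL, _, ⟨DilationEquiv.refl _, by simp⟩, (isConstrainedL_iff _).2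
    ⟨!₂[-1, 2], !₂[0, 1], !₂[0, 3], ?_, ?_, ?_, rfl⟩, ?_⟩
  · intro h; have := (hne _ _ _ _ h).1; norm_num at this
  · intro h; have := (hne _ _ _ _ h).1; norm_num at this
  · norm_num [PiLp.inner_apply]
  · rw [key]
    refine ⟨by simp, Set.ncard_eq_three.2 ⟨_, _, _, ?_, ?_, ?_, rfl⟩⟩
    · intro h; have := (hne _ _ _ _ h).1; norm_num at this
    · intro h; have := (hne _ _ _ _ h).1; norm_num at this
    · intro h; have := (hne _ _ _ _ h).2; norm_num at this

/-! ### The upper bound -/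

/-- The complement of `m` intervals in the line has at most `m + 1` convex pieces. -/
theorem exists_separating_index {ι : Type*} [Fintype ι] {m : ℕ} (hm : Fintype.card ι = m)
    (J : ι → Set ℝ) (hJ : ∀ i, (J i).OrdConnected) :
    ∃ σ : ℝ → Fin (m + 1), ∀ x y, (∀ i, x ∉ J i) → (∀ i, y ∉ J i) → σ x = σ y →
      ∀ z ∈ Set.uIcc x y, ∀ i, z ∉ J i := by
  classical
  -- The label of a point is the number of intervals that reach to its left. It is monotone, and it
  -- increases between two uncovered points as soon as some interval lies between them.
  let left : ℝ → Finset ι := fun x => Finset.univ.filter fun i => ∃ z ∈ J i, z < x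
  have hmono : ∀ x y, x ≤ y → left x ⊆ left y := by
    intro x y hxy i hi
    obtain ⟨z, hz, hzx⟩ := (Finset.mem_filter.1 hi).2
    exact Finset.mem_filter.2 ⟨Finset.mem_univ _, z, hz, hzx.trans_le hxy⟩
  have key : ∀ x y, x ≤ y → (∀ i, x ∉ J i) → (∀ i, y ∉ J i) →
      (left x).card = (left y).card → ∀ z ∈ Set.Icc x y, ∀ i, z ∉ J i := by
    intro x y hxy hx hy h z hz i hzi
    have heq := Finset.eq_of_subset_of_card_le (hmono x y hxy) h.ge
    have h1 : i ∈ left y := Finset.mem_filter.2 ⟨Finset.mem_univ _, z, hzi,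
      lt_of_le_of_ne hz.2 fun h => hy i (h ▸ hzi)⟩
    rw [← heq] at h1
    obtain ⟨w, hw, hwx⟩ := (Finset.mem_filter.1 h1).2
    exact hx i ((hJ i).out hw hzi ⟨hwx.le, hz.1⟩)
  refine ⟨fun x => ⟨(left x).card, Nat.lt_succ_of_le (hm ▸ Finset.card_le_univ _)⟩, ?_⟩
  intro x y hx hy h
  have h' : (left x).card = (left y).card := congrArg Fin.val h
  rcases le_total x y with hxy | hxy
  · rw [Set.uIcc_of_le hxy]; exact key x y hxy hx hy h'
  · rw [Set.uIcc_of_ge hxy]; exact key y x hxy hy hx h'.symm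

theorem isClosed_standardL : IsClosed standardL := by
  rw [← unfold_preimage_axis]
  exact (isClosed_eq continuous_snd continuous_const).preimage unfold.continuous

theorem IsConstrainedL.isClosed {S : Set Plane} (hS : IsConstrainedL S) : IsClosed S := by
  obtain ⟨g, rfl⟩ := hS
  exact g.toHomeomorph.isClosedMap _ isClosed_standardL

/-- Adding one L to `n` others raises the rank by at most `3 * n + 1`. -/
theorem rank_locConst_diff_le {n : ℕ} {S : Fin n → Set Plane} (hS : ∀ i, IsConstrainedL (S i))
    {T : Set Plane} (hT : IsConstrainedL T) :
    Module.rank ℝ (locConst ((⋃ i, S i)ᶜ \ T)) ≤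
      Module.rank ℝ (locConst (⋃ i, S i)ᶜ) + (3 * n + 1 : ℕ) := by
  obtain ⟨g, rfl⟩ := hT
  let e : ℝ × ℝ ≃ₜ Plane := unfold.symm.trans g.toHomeomorph
  have he : ∀ x, e (x, 0) = g (standardPath x) := fun x =>
    congrArg g (unfold_symm_axis x)
  have hU : IsOpen (⋃ i, S i)ᶜ :=
    (isClosed_iUnion_of_finite fun i => (hS i).isClosed).isOpen_compl
  choose J hJ hmem using fun i => ((hS i).preimage g).exists_three_ordConnected
  obtain ⟨σ, hσ⟩ := exists_separating_index (ι := Fin n × Fin 3) (m := 3 * n)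
    (by simp [mul_comm]) (fun p => J p.1 p.2) (fun p => hJ p.1 p.2)
  have hV : ∀ x, (x, (0 : ℝ)) ∈ e ⁻¹' (⋃ i, S i)ᶜ ↔ ∀ p : Fin n × Fin 3, x ∉ J p.1 p.2 := by
    intro x
    have h1 : ∀ i, g (standardPath x) ∈ S i ↔ ∃ k, x ∈ J i k := fun i => hmem i x
    simp [he, h1]
  have h := rank_locConst_diff_axis_le (hU.preimage e.continuous) σ (fun x y hx hy hxy z hz =>
    (hV z).2 (hσ x y ((hV x).1 hx) ((hV y).1 hy) hxy z hz))
  have hset : e ⁻¹' ((⋃ i, S i)ᶜ \ g '' standardL) =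
      e ⁻¹' (⋃ i, S i)ᶜ \ {p | p.2 = 0} := by
    rw [Set.preimage_sdiff]
    congr 1
    ext p
    rw [← unfold_preimage_axis]
    simp [e]
  rw [← hset] at h
  rwa [← (locConstCongr e _).rank_eq, ← (locConstCongr e _).rank_eq] at h

/-- The empty drawing has rank at most 1, and an L added to `k` others contributes at most `3 * k +
1`. -/
theorem rank_locConst_compl_le {n : ℕ} {S : Fin n → Set Plane} (hS : ∀ i, IsConstrainedL (S i)) :
    Module.rank ℝ (locConst (⋃ i, S i)ᶜ) ≤ (3 * n.choose 2 + n + 1 : ℕ) := by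
  induction n with
  | zero =>
    let ev : locConst (⋃ i, S i)ᶜ →ₗ[ℝ] ℝ :=
      { toFun := fun f => f.1 0
        map_add' := fun _ _ => rfl
        map_smul' := fun _ _ => rfl }
    have hev : Function.Injective ev := by
      intro f g hfg
      ext x
      have h : ∀ f ∈ locConst (⋃ i, S i)ᶜ, f x = f 0 := fun f hf =>
        eq_of_mem_locConst hf isPreconnected_univ (by simp) (Set.mem_univ _) (Set.mem_univ _)
      rw [h f.1 f.2, h g.1 g.2]
      exact hfg
    simpa using LinearMap.rank_le_of_injective ev hev
  | succ n ih =>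
    have h1 := rank_locConst_diff_le (fun i : Fin n => hS i.castSucc) (hS (Fin.last n))
    have h2 : (⋃ i, S i)ᶜ = (⋃ i : Fin n, S i.castSucc)ᶜ \ S (Fin.last n) := by
      ext x
      simp [Fin.forall_fin_succ']
    rw [h2]
    refine (h1.trans (add_le_add_left (ih fun i => hS i.castSucc) _)).trans ?_
    have h3 : (n + 1).choose 2 = n + n.choose 2 := by
      rw [Nat.choose_succ_succ' n 1, Nat.choose_one_right]
    rw [h3]
    norm_cast
    omega

theorem regionCount_le {n : ℕ} {S : Fin n → Set Plane} (hS : ∀ i, IsConstrainedL (S i)) :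
    regionCount S ≤ (3 * n.choose 2 + n + 1 : ℕ) :=
  connectedComponents_le_of_rank_le
    (isClosed_iUnion_of_finite fun i => (hS i).isClosed).isOpen_compl (rank_locConst_compl_le hS)

/-! ### Independence of corner indicators -/

/-- The indicator of the region `a * f < 0 ∧ b * g < 0` off `F`. -/
noncomputable def cornerIndicator {X : Type*} (F : Set X) (f g : X → ℝ) (a b : ℝ) : X → ℝ :=
  open Classical in fun x => if x ∉ F ∧ a * f x < 0 ∧ b * g x < 0 then 1 else 0

/-- The indicator can change only at the boundary of the sector, where one function vanishes and the
other has the weak sign of the sector; all such points lie in `F`. -/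
theorem cornerIndicator_mem_locConst {X : Type*} [TopologicalSpace X] {F : Set X}
    (hF : IsClosed F) {f g : X → ℝ} (hf : Continuous f) (hg : Continuous g) {a b : ℝ}
    (ha : a ≠ 0) (hb : b ≠ 0) (hfF : ∀ x, f x = 0 → b * g x ≤ 0 → x ∈ F)
    (hgF : ∀ x, g x = 0 → a * f x ≤ 0 → x ∈ F) :
    cornerIndicator F f g a b ∈ locConst Fᶜ := by
  refine ⟨fun x hx => ?_, fun x hx => if_neg fun h => hx h.1⟩
  have hxF : ∀ᶠ y in nhds x, y ∉ F := hF.isOpen_compl.mem_nhds hx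
  have hcf : Filter.Tendsto (fun y => a * f y) (nhds x) (nhds (a * f x)) :=
    (continuous_const.mul hf).continuousAt
  have hcg : Filter.Tendsto (fun y => b * g y) (nhds x) (nhds (b * g x)) :=
    (continuous_const.mul hg).continuousAt
  have pos_case : 0 < a * f x ∨ 0 < b * g x →
      ∀ᶠ y in nhds x, cornerIndicator F f g a b y = cornerIndicator F f g a b x := by
    intro h
    have h0 : cornerIndicator F f g a b x = 0 :=
      if_neg fun h' => h.elim (fun h => h.not_gt h'.2.1) (fun h => h.not_gt h'.2.2)
    rw [h0]
    rcases h with h | h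
    · filter_upwards [hcf.eventually (lt_mem_nhds h)] with y hy
      exact if_neg fun h' => hy.not_gt h'.2.1
    · filter_upwards [hcg.eventually (lt_mem_nhds h)] with y hy
      exact if_neg fun h' => hy.not_gt h'.2.2
  rcases lt_trichotomy (a * f x) 0 with h1 | h1 | h1
  · rcases lt_trichotomy (b * g x) 0 with h2 | h2 | h2
    · filter_upwards [hcf.eventually (gt_mem_nhds h1), hcg.eventually (gt_mem_nhds h2), hxF]
        with y hy1 hy2 hy3
      have hx' : x ∉ F := hx
      simp only [cornerIndicator, hx', hy1, hy2, hy3, h1, h2, not_false_eq_true, and_self]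
    · exact absurd (hgF x ((mul_eq_zero.1 h2).resolve_left hb) h1.le) hx
    · exact pos_case (Or.inr h2)
  · rcases le_or_gt (b * g x) 0 with h2 | h2
    · exact absurd (hfF x ((mul_eq_zero.1 h1).resolve_left ha) h2) hx
    · exact pos_case (Or.inr h2)
  · exact pos_case (Or.inl h1)

/-- The mixed second difference of a function on the plane at the origin. -/
def mixedDiff (f : ℝ × ℝ → ℝ) (ε : ℝ) : ℝ :=
  f (ε, ε) - f (ε, -ε) - f (-ε, ε) + f (-ε, -ε)

/-- A union `F` of pieces of the curves `h κ = 0` has at least as many complementary regions,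
less one, as there are corners: transversal simple crossings `c` of curves `k c` and `l c`, one of
whose four sectors is bounded by `F`. -/
theorem card_corners_lt_connectedComponents {X K ι : Type*} [TopologicalSpace X] [Finite K]
    [Fintype ι] {F : Set X} (hF : IsClosed F) (hne : Fᶜ.Nonempty) {h : K → X → ℝ}
    (hcont : ∀ κ, Continuous (h κ)) (hFh : ∀ x ∈ F, ∃ κ, h κ x = 0) (k l : ι → K) (a b : ι → ℝ)
    (ha : ∀ c, a c ≠ 0) (hb : ∀ c, b c ≠ 0)
    (hk : ∀ c x, h (k c) x = 0 → b c * h (l c) x ≤ 0 → x ∈ F)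
    (hl : ∀ c x, h (l c) x = 0 → a c * h (k c) x ≤ 0 → x ∈ F)
    (hp : ∀ c, ∃ p : ℝ × ℝ → X, Continuous p ∧ (∀ z, h (k c) (p z) = z.1) ∧
      (∀ z, h (l c) (p z) = z.2) ∧ ∀ κ, κ ≠ k c → κ ≠ l c → h κ (p 0) ≠ 0)
    (hinj : ∀ c c', (k c' = k c ∨ k c' = l c) → (l c' = k c ∨ l c' = l c) → c' = c) :
    ((Fintype.card ι + 1 : ℕ) : ℕ∞) ≤ ENat.card (ConnectedComponents (Fᶜ : Set X)) := by
  classical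
  let D : ι → X → ℝ := fun c => cornerIndicator F (h (k c)) (h (l c)) (a c) (b c)
  have hD : ∀ c, D c ∈ locConst Fᶜ := fun c =>
    cornerIndicator_mem_locConst hF (hcont _) (hcont _) (ha c) (hb c) (hk c) (hl c)
  have hone : Fᶜ.indicator 1 ∈ locConst Fᶜ := by
    refine ⟨fun x hx => ?_, fun x hx => Set.indicator_of_notMem hx _⟩
    filter_upwards [hF.isOpen_compl.mem_nhds hx] with y hy
    rw [Set.indicator_of_mem hx, Set.indicator_of_mem hy]; rfl
  let v : Option ι → locConst Fᶜ := fun o => o.elim ⟨_, hone⟩ fun c => ⟨D c, hD c⟩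
  have hv : LinearIndependent ℝ v := by
    rw [Fintype.linearIndependent_iff]
    intro g hg
    have hg' : ∀ x, g none * Fᶜ.indicator (1 : X → ℝ) x + ∑ c, g (some c) * D c x = 0 := by
      intro x
      have := congrArg (fun f : locConst Fᶜ => f.1 x) hg
      simpa [Fintype.sum_option, v] using this
    -- The relation is tested at the four points `p (±ε, ±ε)` around the crossing `c` and combined
    -- into a mixed second difference, which isolates the coefficient of `c`.
    have hsome : ∀ c, g (some c) = 0 := by
      intro c
      obtain ⟨p, hpc, hp1, hp2, hp3⟩ := hp c
      have hsgn : ∀ s t : ℝ, Filter.Tendsto (fun ε : ℝ => (s * ε, t * ε)) (nhdsWithin 0 (Set.Ioi 0))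
          (nhds 0) := by
        intro s t
        have : Continuous fun ε : ℝ => (s * ε, t * ε) := by fun_prop
        have h0 := (this.tendsto 0).mono_left (nhdsWithin_le_nhds (s := Set.Ioi 0))
        simpa only [mul_zero, Prod.mk_zero_zero] using h0
      have hall : ∀ P : ℝ × ℝ → Prop, (∀ᶠ z in nhds 0, P z) →
          ∀ᶠ ε in nhdsWithin (0 : ℝ) (Set.Ioi 0),
            P (ε, ε) ∧ P (ε, -ε) ∧ P (-ε, ε) ∧ P (-ε, -ε) := by
        intro P hP
        filter_upwards [(hsgn 1 1).eventually hP, (hsgn 1 (-1)).eventually hP,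
          (hsgn (-1) 1).eventually hP, (hsgn (-1) (-1)).eventually hP] with ε h1 h2 h3 h4
        simp only [one_mul, neg_mul] at h1 h2 h3 h4
        exact ⟨h1, h2, h3, h4⟩
      have hconst : ∀ κ, κ ≠ k c → κ ≠ l c → ∀ w : ℝ, w ≠ 0 →
          ∀ᶠ z in nhds 0, (w * h κ (p z) < 0 ↔ w * h κ (p 0) < 0) := by
        intro κ h1 h2 w hw
        have hcw : Filter.Tendsto (fun z => w * h κ (p z)) (nhds 0) (nhds (w * h κ (p 0))) :=
          (continuous_const.mul ((hcont κ).comp hpc)).continuousAt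
        rcases lt_or_gt_of_ne (mul_ne_zero hw (hp3 κ h1 h2)) with h | h
        · filter_upwards [hcw.eventually (gt_mem_nhds h)] with z hz
          exact ⟨fun _ => h, fun _ => hz⟩
        · filter_upwards [hcw.eventually (lt_mem_nhds h)] with z hz
          exact ⟨fun h' => absurd hz h'.not_gt, fun h' => absurd h h'.not_gt⟩
      have hoff : ∀ᶠ ε in nhdsWithin (0 : ℝ) (Set.Ioi 0), p (ε, ε) ∉ F ∧ p (ε, -ε) ∉ F ∧
          p (-ε, ε) ∉ F ∧ p (-ε, -ε) ∉ F := by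
        have h1 : ∀ᶠ z in nhds (0 : ℝ × ℝ), ∀ κ, κ ≠ k c → κ ≠ l c → h κ (p z) ≠ 0 := by
          rw [Filter.eventually_all]
          intro κ
          by_cases h1 : κ ≠ k c ∧ κ ≠ l c
          · have := ((hcont κ).comp hpc).continuousAt.eventually_ne (hp3 κ h1.1 h1.2)
            filter_upwards [this] with z hz _ _ using hz
          · filter_upwards with z h2 h3 using absurd ⟨h2, h3⟩ h1
        have h2 : ∀ z : ℝ × ℝ, z.1 ≠ 0 → z.2 ≠ 0 →
            (∀ κ, κ ≠ k c → κ ≠ l c → h κ (p z) ≠ 0) → p z ∉ F := by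
          intro z hz1 hz2 hz hzF
          obtain ⟨κ, hκ⟩ := hFh _ hzF
          by_cases h3 : κ = k c
          · exact hz1 (by rw [← hp1 z, ← h3, hκ])
          by_cases h4 : κ = l c
          · exact hz2 (by rw [← hp2 z, ← h4, hκ])
          exact hz κ h3 h4 hκ
        filter_upwards [hall _ h1, self_mem_nhdsWithin] with ε hε hpos
        have hpos : (0 : ℝ) < ε := hpos
        have hneg : -ε ≠ 0 := neg_ne_zero.2 hpos.ne'
        exact ⟨h2 _ hpos.ne' hpos.ne' hε.1, h2 _ hpos.ne' hneg hε.2.1,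
          h2 _ hneg hpos.ne' hε.2.2.1, h2 _ hneg hneg hε.2.2.2⟩
      -- By `hinj` at least one of the two curves of `c'` is neither `k c` nor `l c`, hence misses
      -- the crossing. Its sign is locally constant, so `D c'` depends on at most one local
      -- coordinate.
      have hother : ∀ c', c' ≠ c → ∀ᶠ ε in nhdsWithin (0 : ℝ) (Set.Ioi 0),
          mixedDiff (fun z => D c' (p z)) ε = 0 := by
        intro c' hc'
        have hone_sided : ∀ κ, ∀ w : ℝ, w ≠ 0 → ∀ᶠ ε in nhdsWithin (0 : ℝ) (Set.Ioi 0),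
            ((w * h κ (p (ε, ε)) < 0 ↔ w * h κ (p (ε, -ε)) < 0) ∧
              (w * h κ (p (-ε, ε)) < 0 ↔ w * h κ (p (-ε, -ε)) < 0)) ∨
            ((w * h κ (p (ε, ε)) < 0 ↔ w * h κ (p (-ε, ε)) < 0) ∧
              (w * h κ (p (ε, -ε)) < 0 ↔ w * h κ (p (-ε, -ε)) < 0)) := by
          intro κ w hw
          by_cases h1 : κ = k c
          · subst h1
            filter_upwards with ε
            left
            simp only [hp1, and_self]
          by_cases h2 : κ = l c
          · subst h2
            filter_upwards with ε
            right
            simp only [hp2, and_self]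
          filter_upwards [hall _ (hconst κ h1 h2 w hw)] with ε hε
          left
          exact ⟨hε.1.trans hε.2.1.symm, hε.2.2.1.trans hε.2.2.2.symm⟩
        by_cases hk' : k c' = k c ∨ k c' = l c
        · have hl' : ¬ (l c' = k c ∨ l c' = l c) := fun hl' => hc' (hinj c c' hk' hl')
          push Not at hl'
          filter_upwards [hall _ (hconst _ hl'.1 hl'.2 (b c') (hb c')),
            hone_sided (k c') (a c') (ha c'), hoff] with ε h1 h2 h3
          simp only [mixedDiff, D, cornerIndicator, h1, h3, not_false_eq_true, true_and]
          rcases h2 with h2 | h2 <;> simp only [h2] <;> ring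
        · push Not at hk'
          filter_upwards [hall _ (hconst _ hk'.1 hk'.2 (a c') (ha c')),
            hone_sided (l c') (b c') (hb c'), hoff] with ε h1 h2 h3
          simp only [mixedDiff, D, cornerIndicator, h1, h3, not_false_eq_true, true_and]
          rcases h2 with h2 | h2 <;> simp only [h2] <;> ring
      -- In the local coordinates the sector contains exactly one of the four test points, so the
      -- difference is `1` or `-1`.
      have hself : ∀ᶠ ε in nhdsWithin (0 : ℝ) (Set.Ioi 0),
          mixedDiff (fun z => D c (p z)) ε ≠ 0 := by
        filter_upwards [hoff, self_mem_nhdsWithin] with ε h3 hpos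
        have hpos : (0 : ℝ) < ε := hpos
        simp only [mixedDiff, D, cornerIndicator, h3, not_false_eq_true, true_and, hp1, hp2]
        have hsign : ∀ w : ℝ, w ≠ 0 →
            (w * ε < 0 ∧ ¬ w * -ε < 0) ∨ (¬ w * ε < 0 ∧ w * -ε < 0) := by
          intro w hw
          rcases lt_or_gt_of_ne hw with h | h
          · have := mul_neg_of_neg_of_pos h hpos
            exact Or.inl ⟨this, by linarith⟩
          · have := mul_pos h hpos
            exact Or.inr ⟨by linarith, by linarith⟩
        rcases hsign _ (ha c) with h1 | h1 <;> rcases hsign _ (hb c) with h2 | h2 <;>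
          simp only [h1, h2, and_self, and_true, and_false, if_true, if_false] <;> norm_num
      obtain ⟨ε, h1, h2, h3⟩ := ((Filter.eventually_all.2 fun c' =>
        Filter.eventually_imp_distrib_left.2 (hother c')).and (hself.and hoff)).exists
      have h4 : ∀ f₁ f₂ f₃ f₄ : ℝ, f₁ = 0 → f₂ = 0 → f₃ = 0 → f₄ = 0 →
        f₁ - f₂ - f₃ + f₄ = 0 := by intros; simp_all
      have h5 := h4 _ _ _ _ (hg' (p (ε, ε))) (hg' (p (ε, -ε))) (hg' (p (-ε, ε)))
        (hg' (p (-ε, -ε)))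
      have h6 : ∑ c', g (some c') * mixedDiff (fun z => D c' (p z)) ε = 0 := by
        simp only [Set.indicator_of_mem (show p _ ∈ Fᶜ from h3.1),
          Set.indicator_of_mem (show p _ ∈ Fᶜ from h3.2.1),
          Set.indicator_of_mem (show p _ ∈ Fᶜ from h3.2.2.1),
          Set.indicator_of_mem (show p _ ∈ Fᶜ from h3.2.2.2), Pi.one_apply] at h5
        simp only [mixedDiff, mul_add, mul_sub, Finset.sum_add_distrib, Finset.sum_sub_distrib]
        linarith
      rw [Finset.sum_eq_single c (fun c' _ hc' => by rw [h1 c' hc', mul_zero])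
        (fun h => absurd (Finset.mem_univ c) h)] at h6
      exact (mul_eq_zero.1 h6).resolve_right h2
    rintro (_ | c)
    · obtain ⟨x, hx⟩ := hne
      have := hg' x
      simpa [hsome, Set.indicator_of_mem hx] using this
    · exact hsome c
  have := card_le_connectedComponents hv
  rwa [Fintype.card_option] at this

/-! ### Tangents of a circle and their crossings -/

/-- The signed distance from the line with unit normal at angle `θ` that is tangent to the circle
with centre `O` and radius `ρ`. -/
noncomputable def tangentFun (O : Plane) (ρ θ : ℝ) (x : Plane) : ℝ :=
  (x 0 - O 0) * Real.cos θ + (x 1 - O 1) * Real.sin θ - ρ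

theorem continuous_tangentFun (O : Plane) (ρ θ : ℝ) : Continuous (tangentFun O ρ θ) := by
  unfold tangentFun
  fun_prop

/-- The point with signed distances `z.1` and `z.2` from the tangents at angles `u` and `v`. -/
noncomputable def tangentCoord (O : Plane) (ρ u v : ℝ) (z : ℝ × ℝ) : Plane :=
  !₂[O 0 + ((ρ + z.1) * Real.sin v - (ρ + z.2) * Real.sin u) / Real.sin (v - u),
    O 1 + ((ρ + z.2) * Real.cos u - (ρ + z.1) * Real.cos v) / Real.sin (v - u)]

theorem continuous_tangentCoord (O : Plane) (ρ u v : ℝ) : Continuous (tangentCoord O ρ u v) := by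
  unfold tangentCoord
  fun_prop

theorem tangentFun_tangentCoord_left (O : Plane) (ρ u v : ℝ) (h : Real.sin (v - u) ≠ 0)
    (z : ℝ × ℝ) : tangentFun O ρ u (tangentCoord O ρ u v z) = z.1 := by
  simp only [tangentFun, tangentCoord, PiLp.toLp_apply, Matrix.cons_val_zero, Matrix.cons_val_one,
    add_sub_cancel_left]
  field_simp
  rw [Real.sin_sub]
  ring

theorem tangentFun_tangentCoord_right (O : Plane) (ρ u v : ℝ) (h : Real.sin (v - u) ≠ 0)
    (z : ℝ × ℝ) : tangentFun O ρ v (tangentCoord O ρ u v z) = z.2 := by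
  simp only [tangentFun, tangentCoord, PiLp.toLp_apply, Matrix.cons_val_zero, Matrix.cons_val_one,
    add_sub_cancel_left]
  field_simp
  rw [Real.sin_sub]
  ring

theorem sin_add_sin_sub_sin_add (x y : ℝ) : Real.sin (2 * x) + Real.sin (2 * y) -
    Real.sin (2 * x + 2 * y) = 4 * Real.sin x * Real.sin y * Real.sin (x + y) := by
  have hx := Real.sin_sq_add_cos_sq x
  have hy := Real.sin_sq_add_cos_sq y
  rw [Real.sin_add (2 * x), Real.sin_add, Real.sin_two_mul, Real.sin_two_mul, Real.cos_two_mul,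
    Real.cos_two_mul]
  linear_combination (-4 * Real.sin y * Real.cos y) * hx - (4 * Real.sin x * Real.cos x) * hy

/-- Solving the two tangent equations gives the numerator `sin (v - w) + sin (w - u) - sin (v - u)`;
its product form makes the sign readable. -/
theorem tangentFun_crossing (O : Plane) (ρ u v w : ℝ) (h : Real.sin (v - u) ≠ 0) :
    tangentFun O ρ w (tangentCoord O ρ u v 0) =
      ρ * (4 * Real.sin ((v - w) / 2) * Real.sin ((w - u) / 2) * Real.sin ((v - u) / 2)) /
        Real.sin (v - u) := by
  have h1 := sin_add_sin_sub_sin_add ((v - w) / 2) ((w - u) / 2)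
  rw [mul_div_cancel₀ _ two_ne_zero, mul_div_cancel₀ _ two_ne_zero,
    show v - w + (w - u) = v - u by ring,
    show (v - w) / 2 + (w - u) / 2 = (v - u) / 2 by ring] at h1
  rw [← h1]
  simp only [tangentFun, tangentCoord, PiLp.toLp_apply, Matrix.cons_val_zero, Matrix.cons_val_one,
    add_sub_cancel_left, Prod.fst_zero, Prod.snd_zero, add_zero]
  field_simp
  rw [Real.sin_sub v w, Real.sin_sub w u]
  ring

theorem tangentFun_crossing_ne_zero (O : Plane) {ρ u v w : ℝ} (hρ : 0 < ρ) (huv : u < v)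
    (hvu : v < u + Real.pi) (hwu : w < u + Real.pi) (hvw : v < w + Real.pi) (h1 : w ≠ u)
    (h2 : w ≠ v) : tangentFun O ρ w (tangentCoord O ρ u v 0) ≠ 0 := by
  have hs : 0 < Real.sin (v - u) := Real.sin_pos_of_pos_of_lt_pi (by linarith) (by linarith)
  have hs' : 0 < Real.sin ((v - u) / 2) :=
    Real.sin_pos_of_pos_of_lt_pi (by linarith) (by linarith)
  have half : ∀ x : ℝ, x ≠ 0 → -Real.pi < x → x < Real.pi → Real.sin (x / 2) ≠ 0 := by
    intro x hx hx1 hx2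
    rw [Ne, Real.sin_eq_zero_iff_of_lt_of_lt (by linarith) (by linarith)]
    simpa using hx
  have h3 := half (v - w) (sub_ne_zero.2 h2.symm) (by linarith) (by linarith)
  have h4 := half (w - u) (sub_ne_zero.2 h1) (by linarith) (by linarith)
  rw [tangentFun_crossing O ρ u v w hs.ne']
  positivity

/-- A crossing lies beyond only those tangents whose normal angle is strictly between `u` and `v`;
otherwise the two half-angle sines involving `w` do not have the same strict sign. -/
theorem tangentFun_crossing_nonpos (O : Plane) {ρ u v w : ℝ} (hρ : 0 < ρ) (huv : u < v)
    (hvu : v < u + Real.pi) (hwu : w < u + Real.pi) (hvw : v < w + Real.pi)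
    (h : w ≤ u ∨ v ≤ w) : tangentFun O ρ w (tangentCoord O ρ u v 0) ≤ 0 := by
  have hs : 0 < Real.sin (v - u) := Real.sin_pos_of_pos_of_lt_pi (by linarith) (by linarith)
  have hs' : 0 < Real.sin ((v - u) / 2) :=
    Real.sin_pos_of_pos_of_lt_pi (by linarith) (by linarith)
  rw [tangentFun_crossing O ρ u v w hs.ne']
  refine div_nonpos_of_nonpos_of_nonneg (mul_nonpos_of_nonneg_of_nonpos hρ.le
    (mul_nonpos_of_nonpos_of_nonneg ?_ hs'.le)) hs.le
  rcases h with h | h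
  · have h1 : 0 ≤ Real.sin ((v - w) / 2) :=
      Real.sin_nonneg_of_nonneg_of_le_pi (by linarith) (by linarith)
    have h2 : Real.sin ((w - u) / 2) ≤ 0 :=
      Real.sin_nonpos_of_nonpos_of_neg_pi_le (by linarith) (by linarith)
    exact mul_nonpos_of_nonneg_of_nonpos (by positivity) h2
  · have h1 : 0 ≤ Real.sin ((w - u) / 2) :=
      Real.sin_nonneg_of_nonneg_of_le_pi (by linarith) (by linarith)
    have h2 : Real.sin ((v - w) / 2) ≤ 0 :=
      Real.sin_nonpos_of_nonpos_of_neg_pi_le (by linarith) (by linarith)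
    exact mul_nonpos_of_nonpos_of_nonneg (by linarith) h1

theorem cos_sub_ne_zero_of_perp {u u' v : ℝ} (h : u' = u + Real.pi / 2 ∨ u' = u - Real.pi / 2)
    (hs : Real.sin (v - u) ≠ 0) : Real.cos (u' - v) ≠ 0 := by
  rcases h with rfl | rfl
  · rwa [show u + Real.pi / 2 - v = Real.pi / 2 - (v - u) by ring, Real.cos_pi_div_two_sub]
  · rwa [show u - Real.pi / 2 - v = -((v - u) + Real.pi / 2) by ring, Real.cos_neg,
      Real.cos_add_pi_div_two, neg_ne_zero]

/-- On the tangent at angle `u`, the half-line on which `tangentFun O ρ v` has the sign opposite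
to `cos (u' - v)` lies behind any of its points `q` on the tangent at `v`, seen along the
perpendicular direction `u'`. -/
theorem tangentFun_le_of_perp (O : Plane) {ρ u u' v : ℝ}
    (h : u' = u + Real.pi / 2 ∨ u' = u - Real.pi / 2) (hs : Real.sin (v - u) ≠ 0) {x q : Plane}
    (hx : tangentFun O ρ u x = 0) (hqu : tangentFun O ρ u q = 0) (hqv : tangentFun O ρ v q = 0)
    (hxv : Real.cos (u' - v) * tangentFun O ρ v x ≤ 0) :
    tangentFun O ρ u' x ≤ tangentFun O ρ u' q := by
  have hb := cos_sub_ne_zero_of_perp h hs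
  -- The unit normal at `v` is expanded in the orthonormal frame of the normals at `u` and `u'`.
  have key : ∀ y, tangentFun O ρ v y + ρ = Real.cos (v - u) * (tangentFun O ρ u y + ρ) +
      Real.cos (u' - v) * (tangentFun O ρ u' y + ρ) := by
    intro y
    have h1 := Real.sin_sq_add_cos_sq u
    rcases h with rfl | rfl
    · simp only [tangentFun, Real.cos_sub, Real.cos_add_pi_div_two, Real.sin_add_pi_div_two]
      linear_combination (-(y 0 - O 0) * Real.cos v - (y 1 - O 1) * Real.sin v) * h1
    · simp only [tangentFun, Real.cos_sub, Real.sin_sub, Real.cos_pi_div_two, Real.sin_pi_div_two]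
      linear_combination (-(y 0 - O 0) * Real.cos v - (y 1 - O 1) * Real.sin v) * h1
  have h1 := key x
  have h2 := key q
  rw [hx] at h1
  rw [hqu, hqv] at h2
  have h3 : tangentFun O ρ v x =
      Real.cos (u' - v) * (tangentFun O ρ u' x - tangentFun O ρ u' q) := by linarith
  rw [h3, ← mul_assoc] at hxv
  have h4 : 0 < Real.cos (u' - v) * Real.cos (u' - v) := mul_self_pos.2 hb
  by_contra h5
  have := mul_pos h4 (sub_pos.2 (not_le.1 h5))
  linarith

/-- The point at angle `φ` on the circle with centre `O` and radius `r`. -/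
noncomputable def polarPoint (O : Plane) (r φ : ℝ) : Plane :=
  O + r • !₂[Real.cos φ, Real.sin φ]

theorem tangentFun_add_pi_div_four (O : Plane) (r φ : ℝ) (x : Plane) :
    tangentFun O (r * (√2 / 2)) (φ + Real.pi / 4) x = √2 / 2 *
      ((x 0 - O 0) * (Real.cos φ - Real.sin φ) +
        (x 1 - O 1) * (Real.sin φ + Real.cos φ) - r) := by
  simp only [tangentFun, Real.cos_add, Real.sin_add, Real.cos_pi_div_four, Real.sin_pi_div_four]
  ring

theorem tangentFun_sub_pi_div_four (O : Plane) (r φ : ℝ) (x : Plane) :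
    tangentFun O (r * (√2 / 2)) (φ - Real.pi / 4) x = √2 / 2 *
      ((x 0 - O 0) * (Real.cos φ + Real.sin φ) +
        (x 1 - O 1) * (Real.sin φ - Real.cos φ) - r) := by
  simp only [tangentFun, Real.cos_sub, Real.sin_sub, Real.cos_pi_div_four, Real.sin_pi_div_four]
  ring

/-- The sides of an inscribed square touch the circle of radius `r * (√2 / 2)`, and their normals at
a vertex are turned by `π / 4` either way. Each side is cut off by the line of the other. -/
theorem rayFrom_polarPoint_add (O : Plane) {r : ℝ} (hr : 0 < r) (φ : ℝ) :
    rayFrom (polarPoint O r φ) (polarPoint O r (φ + Real.pi / 2)) =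
      {x | tangentFun O (r * (√2 / 2)) (φ + Real.pi / 4) x = 0 ∧
        tangentFun O (r * (√2 / 2)) (φ - Real.pi / 4) x ≤ 0} := by
  have h1 := Real.sin_sq_add_cos_sq φ
  have h2 : 0 < √2 / 2 := by positivity
  ext x
  simp only [rayFrom, Set.mem_ofPred_eq, tangentFun_add_pi_div_four,
    tangentFun_sub_pi_div_four, polarPoint, Real.cos_add_pi_div_two,
    Real.sin_add_pi_div_two]
  constructor
  · rintro ⟨t, ht, rfl⟩
    simp
    constructor
    · linear_combination r * h1
    · have : 0 ≤ √2 / 2 * (2 * r * t) := by positivity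
      linear_combination this + (√2 / 2 * r * (1 - 2 * t)) * h1
  · rintro ⟨h3, h4⟩
    have h3 := (mul_eq_zero.1 h3).resolve_left h2.ne'
    have h4 := nonpos_of_mul_nonpos_right h4 h2
    refine ⟨-((x 0 - O 0) * (Real.cos φ + Real.sin φ) +
      (x 1 - O 1) * (Real.sin φ - Real.cos φ) - r) / (2 * r), by
        apply div_nonneg <;> linarith, ?_⟩
    ext i
    fin_cases i
    · simp
      field_simp
      linear_combination (Real.cos φ - Real.sin φ) * h3 + (-2 * (x 0 - O 0)) * h1
    · simp
      field_simp
      linear_combination (Real.cos φ + Real.sin φ) * h3 + (-2 * (x 1 - O 1)) * h1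

theorem rayFrom_polarPoint_sub (O : Plane) {r : ℝ} (hr : 0 < r) (φ : ℝ) :
    rayFrom (polarPoint O r φ) (polarPoint O r (φ - Real.pi / 2)) =
      {x | tangentFun O (r * (√2 / 2)) (φ - Real.pi / 4) x = 0 ∧
        tangentFun O (r * (√2 / 2)) (φ + Real.pi / 4) x ≤ 0} := by
  have h1 := Real.sin_sq_add_cos_sq φ
  have h2 : 0 < √2 / 2 := by positivity
  ext x
  simp only [rayFrom, Set.mem_ofPred_eq, tangentFun_add_pi_div_four,
    tangentFun_sub_pi_div_four, polarPoint, Real.cos_sub_pi_div_two,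
    Real.sin_sub_pi_div_two]
  constructor
  · rintro ⟨t, ht, rfl⟩
    simp
    constructor
    · linear_combination r * h1
    · have : 0 ≤ √2 / 2 * (2 * r * t) := by positivity
      linear_combination this + (√2 / 2 * r * (1 - 2 * t)) * h1
  · rintro ⟨h3, h4⟩
    have h3 := (mul_eq_zero.1 h3).resolve_left h2.ne'
    have h4 := nonpos_of_mul_nonpos_right h4 h2
    refine ⟨-((x 0 - O 0) * (Real.cos φ - Real.sin φ) +
      (x 1 - O 1) * (Real.sin φ + Real.cos φ) - r) / (2 * r), by
        apply div_nonneg <;> linarith, ?_⟩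
    ext i
    fin_cases i
    · simp
      field_simp
      linear_combination (Real.cos φ + Real.sin φ) * h3 + (-2 * (x 0 - O 0)) * h1
    · simp
      field_simp
      linear_combination (Real.sin φ - Real.cos φ) * h3 + (-2 * (x 1 - O 1)) * h1

/-! ### The square construction -/

/-- The angle of the normal of the `κ`-th of the `2 * n` lines in the square construction. -/
noncomputable def lineAngle (α : ℝ) (n κ : ℕ) : ℝ :=
  α - Real.pi / 4 + Real.pi * κ / (2 * n)

theorem lineAngle_add (α : ℝ) {n : ℕ} (hn : 0 < n) (κ : ℕ) :
    lineAngle α n (κ + n) = lineAngle α n κ + Real.pi / 2 := by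
  have : (n : ℝ) ≠ 0 := by positivity
  unfold lineAngle
  push_cast
  field_simp
  ring

theorem lineAngle_lt (α : ℝ) {n : ℕ} (hn : 0 < n) {κ μ : ℕ} (h : κ < μ) :
    lineAngle α n κ < lineAngle α n μ := by
  have h' : (κ : ℝ) < μ := by exact_mod_cast h
  unfold lineAngle
  have := Real.pi_pos
  gcongr

theorem lineAngle_le (α : ℝ) {n κ μ : ℕ} (h : κ ≤ μ) :
    lineAngle α n κ ≤ lineAngle α n μ := by
  have h' : (κ : ℝ) ≤ μ := by exact_mod_cast h
  unfold lineAngle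
  have := Real.pi_pos
  gcongr

/-- The `2 * n` normals lie in a window shorter than `π`, where the signs of the sines in the
crossing formula are known. -/
theorem lineAngle_lt_add_pi (α : ℝ) {n : ℕ} (hn : 0 < n) {κ μ : ℕ} (h : κ < 2 * n) :
    lineAngle α n κ < lineAngle α n μ + Real.pi := by
  have h1 := lineAngle_lt α hn (h.trans_le (Nat.le_add_left _ μ))
  have h2 := lineAngle_add α hn μ
  have h3 := lineAngle_add α hn (μ + n)
  rw [show μ + n + n = μ + 2 * n by ring] at h3
  linarith

theorem squareCorner_eq (O : Plane) (r α : ℝ) {n : ℕ} (hn : 0 < n) (i : ℕ) :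
    squareCorner O r α n i =
      rayFrom (polarPoint O r (lineAngle α n i + Real.pi / 4))
        (polarPoint O r (lineAngle α n i + Real.pi / 4 + Real.pi / 2)) ∪
      rayFrom (polarPoint O r (lineAngle α n i + Real.pi / 4))
        (polarPoint O r (lineAngle α n i + Real.pi / 4 - Real.pi / 2)) := by
  have hn' : (n : ℝ) ≠ 0 := by positivity
  have h0 : ∀ k : ℕ, α + 2 * Real.pi * k / (4 * n) = lineAngle α n k + Real.pi / 4 := by
    intro k
    unfold lineAngle
    field_simp
    ring
  have h3 : polarPoint O r (lineAngle α n (i + 3 * n) + Real.pi / 4) =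
      polarPoint O r (lineAngle α n i + Real.pi / 4 - Real.pi / 2) := by
    have : lineAngle α n (i + 3 * n) + Real.pi / 4 =
        lineAngle α n i + Real.pi / 4 - Real.pi / 2 + 2 * Real.pi := by
      unfold lineAngle
      push_cast
      field_simp
      ring
    rw [polarPoint, this, Real.cos_add_two_pi, Real.sin_add_two_pi, polarPoint]
  have h1 : lineAngle α n (i + n) + Real.pi / 4 =
      lineAngle α n i + Real.pi / 4 + Real.pi / 2 := by
    rw [lineAngle_add α hn]; ring
  rw [← h3, ← h1]
  simp only [squareCorner, circlePoint, polarPoint, h0]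

theorem mem_squareCorner_iff (O : Plane) {r : ℝ} (hr : 0 < r) (α : ℝ) {n : ℕ} (hn : 0 < n)
    (i : ℕ) (x : Plane) : x ∈ squareCorner O r α n i ↔
      (tangentFun O (r * (√2 / 2)) (lineAngle α n (i + n)) x = 0 ∧
        tangentFun O (r * (√2 / 2)) (lineAngle α n i) x ≤ 0) ∨
      (tangentFun O (r * (√2 / 2)) (lineAngle α n i) x = 0 ∧
        tangentFun O (r * (√2 / 2)) (lineAngle α n (i + n)) x ≤ 0) := by
  rw [squareCorner_eq O r α hn, rayFrom_polarPoint_add O hr, rayFrom_polarPoint_sub O hr,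
    lineAngle_add α hn, add_sub_cancel_right,
    show lineAngle α n i + Real.pi / 4 + Real.pi / 4 = lineAngle α n i + Real.pi / 2 by ring]
  rfl

theorem isConstrainedL_squareCorner (O : Plane) {r : ℝ} (hr : 0 < r) (α : ℝ) {n : ℕ}
    (hn : 0 < n) (i : ℕ) : IsConstrainedL (squareCorner O r α n i) := by
  rw [squareCorner_eq O r α hn]
  generalize lineAngle α n i + Real.pi / 4 = φ
  have h1 := Real.sin_sq_add_cos_sq φ
  refine (isConstrainedL_iff _).2 ⟨_, _, _, ?_, ?_, ?_, rfl⟩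
  · intro h
    have h2 := congrFun (congrArg WithLp.ofLp h) 0
    have h3 := congrFun (congrArg WithLp.ofLp h) 1
    simp [polarPoint, Real.cos_add_pi_div_two, Real.sin_add_pi_div_two, hr.ne'] at h2 h3
    rw [h3] at h1 h2
    have h4 : Real.sin φ = 0 := (mul_eq_zero.1 (by linarith : r * Real.sin φ = 0)).resolve_left hr.ne'
    simp [h4] at h1
  · intro h
    have h2 := congrFun (congrArg WithLp.ofLp h) 0
    have h3 := congrFun (congrArg WithLp.ofLp h) 1
    simp [polarPoint, Real.cos_sub_pi_div_two, Real.sin_sub_pi_div_two, hr.ne'] at h2 h3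
    rw [h2] at h1 h3
    have h4 : Real.cos φ = 0 := (mul_eq_zero.1 (by linarith : r * Real.cos φ = 0)).resolve_left hr.ne'
    simp [h4] at h1
  · simp [polarPoint, PiLp.inner_apply, Real.cos_add_pi_div_two, Real.sin_add_pi_div_two,
      Real.cos_sub_pi_div_two, Real.sin_sub_pi_div_two]
    ring

theorem sum_range_sub_add_choose {m N : ℕ} (h : m ≤ N) :
    ∑ d ∈ Finset.range m, (N - (d + 1)) + (m + 1).choose 2 = m * N := by
  induction m with
  | zero => simp
  | succ m ih =>
    have h1 := ih (by omega)
    have h2 : (m + 1 + 1).choose 2 = m + 1 + (m + 1).choose 2 := by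
      rw [Nat.choose_succ_succ' (m + 1) 1, Nat.choose_one_right]
    rw [Finset.sum_range_succ, h2, add_mul]
    omega

/-- The square construction has at least `3 * n.choose 2 + n + 1` regions. -/
theorem le_regionCount_squareCorner (O : Plane) {r : ℝ} (hr : 0 < r) (α : ℝ) (n : ℕ) :
    ((3 * n.choose 2 + n + 1 : ℕ) : ℕ∞) ≤
      regionCount (fun i : Fin n => squareCorner O r α n i) := by
  have hpi := Real.pi_pos
  let ρ := r * (√2 / 2)
  have hρ : 0 < ρ := by positivity
  let θ : Fin (2 * n) → ℝ := fun κ => lineAngle α n κ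
  let h : Fin (2 * n) → Plane → ℝ := fun κ => tangentFun O ρ (θ κ)
  let F : Set Plane := ⋃ i : Fin n, squareCorner O r α n i
  -- A corner is a pair of lines `j` and `j + (d + 1)`, so the index gap runs from 1 to `n`; gap `n`
  -- is the centre of an L.
  let ι := Σ d : Fin n, Fin (2 * n - (d + 1))
  let k : ι → Fin (2 * n) := fun c => ⟨c.2, by have := c.2.2; omega⟩
  let l : ι → Fin (2 * n) := fun c => ⟨c.2 + (c.1 + 1), by have := c.2.2; omega⟩
  have hpos : Fin (2 * n) → 0 < n := fun κ => by have := κ.2; omega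
  have hFh : ∀ x ∈ F, ∃ κ, h κ x = 0 := by
    intro x hx
    obtain ⟨i, hi⟩ := Set.mem_iUnion.1 hx
    rcases (mem_squareCorner_iff O hr α i.pos i x).1 hi with h' | h'
    · exact ⟨⟨i + n, by omega⟩, h'.1⟩
    · exact ⟨⟨i, by omega⟩, h'.1⟩
  -- The mate is the perpendicular line of the same L, at index distance exactly `n`; line `κ`
  -- belongs to the drawing where the mate's function is nonpositive.
  have hmate : ∀ κ : Fin (2 * n), ∃ κ' : Fin (2 * n),
      (κ'.val = κ + n ∨ κ.val = κ' + n) ∧ ∀ x, h κ x = 0 → h κ' x ≤ 0 → x ∈ F := by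
    intro κ
    by_cases hκ : κ.val < n
    · refine ⟨⟨κ + n, by omega⟩, Or.inl rfl, fun x h1 h2 => ?_⟩
      exact Set.mem_iUnion.2 ⟨⟨κ, hκ⟩, (mem_squareCorner_iff O hr α (hpos κ) κ x).2
        (Or.inr ⟨h1, h2⟩)⟩
    · obtain ⟨i, hi⟩ : ∃ i, κ.val = i + n := ⟨κ - n, by omega⟩
      have hin : i < n := by omega
      refine ⟨⟨i, by omega⟩, Or.inr hi, fun x h1 h2 => ?_⟩
      refine Set.mem_iUnion.2 ⟨⟨i, hin⟩, (mem_squareCorner_iff O hr α (hpos κ) i x).2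
        (Or.inl ⟨?_, h2⟩)⟩
      rw [← hi]
      exact h1
  choose mate hmate hmateF using hmate
  have hperp : ∀ κ, θ (mate κ) = θ κ + Real.pi / 2 ∨ θ (mate κ) = θ κ - Real.pi / 2 := by
    intro κ
    rcases hmate κ with h' | h'
    · left
      simp only [θ, h', lineAngle_add α (hpos κ)]
    · right
      simp only [θ, h', lineAngle_add α (hpos κ)]
      ring
  have hkl : ∀ c, θ (k c) < θ (l c) := fun c =>
    lineAngle_lt α (hpos (k c)) (by simp only [k, l]; omega)
  have hwin : ∀ κ μ, θ κ < θ μ + Real.pi := fun κ μ => lineAngle_lt_add_pi α (hpos κ) κ.2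
  have hsin : ∀ c, Real.sin (θ (l c) - θ (k c)) ≠ 0 := fun c =>
    (Real.sin_pos_of_pos_of_lt_pi (by linarith [hkl c]) (by linarith [hwin (l c) (k c)])).ne'
  have hsin' : ∀ c, Real.sin (θ (k c) - θ (l c)) ≠ 0 := fun c => by
    rw [← neg_sub, Real.sin_neg, neg_ne_zero]
    exact hsin c
  have hle : ∀ κ μ : Fin (2 * n), κ.val ≤ μ.val → θ κ ≤ θ μ := fun κ μ h' => lineAngle_le α h'
  have hinjθ : ∀ κ μ : Fin (2 * n), κ ≠ μ → θ κ ≠ θ μ := by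
    intro κ μ hne
    rcases lt_or_gt_of_ne (fun h' => hne (Fin.ext h') : κ.val ≠ μ.val) with h' | h'
    · exact (lineAngle_lt α (hpos κ) h').ne
    · exact (lineAngle_lt α (hpos κ) h').ne'
  have key := card_corners_lt_connectedComponents (F := F) (h := h)
    (isClosed_iUnion_of_finite fun i : Fin n =>
      (isConstrainedL_squareCorner O hr α i.pos i).isClosed)
    ⟨O, fun hO => by
      obtain ⟨κ, hκ⟩ := hFh O hO
      simp only [h, tangentFun] at hκ
      linarith⟩
    (fun κ => continuous_tangentFun O ρ _) hFh k l
    -- These cosines orient the sector: their signs select, on each of the two lines, the half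
    -- beyond the crossing as seen from the centre of its L.
    (fun c => Real.cos (θ (mate (l c)) - θ (k c))) (fun c => Real.cos (θ (mate (k c)) - θ (l c)))
    (fun c => cos_sub_ne_zero_of_perp (hperp _) (hsin' c))
    (fun c => cos_sub_ne_zero_of_perp (hperp _) (hsin c))
    -- The gap is at most `n`, so the mate's index is not strictly between those of the two lines.
    -- The crossing is therefore on the ray, and so is everything behind it.
    (fun c x h1 h2 => hmateF _ x h1 ((tangentFun_le_of_perp O (hperp (k c)) (hsin c) h1
      (tangentFun_tangentCoord_left O ρ _ _ (hsin c) 0)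
      (tangentFun_tangentCoord_right O ρ _ _ (hsin c) 0) h2).trans
      (tangentFun_crossing_nonpos O hρ (hkl c) (hwin _ _) (hwin _ _) (hwin _ _) (by
        rcases hmate (k c) with h' | h'
        · right
          apply hle
          simp only [h', k, l]
          omega
        · left
          apply hle
          omega))))
    (fun c x h1 h2 => hmateF _ x h1 ((tangentFun_le_of_perp O (hperp (l c)) (hsin' c) h1
      (tangentFun_tangentCoord_right O ρ _ _ (hsin c) 0)
      (tangentFun_tangentCoord_left O ρ _ _ (hsin c) 0) h2).trans
      (tangentFun_crossing_nonpos O hρ (hkl c) (hwin _ _) (hwin _ _) (hwin _ _) (by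
        rcases hmate (l c) with h' | h'
        · right
          apply hle
          omega
        · left
          apply hle
          have h3 : (l c).val = c.2.val + (c.1.val + 1) := rfl
          have h4 := c.1.2
          change (mate (l c)).val ≤ c.2.val
          omega))))
    (fun c => ⟨tangentCoord O ρ (θ (k c)) (θ (l c)), continuous_tangentCoord O ρ _ _,
      tangentFun_tangentCoord_left O ρ _ _ (hsin c),
      tangentFun_tangentCoord_right O ρ _ _ (hsin c), fun κ h1 h2 =>
        tangentFun_crossing_ne_zero O hρ (hkl c) (hwin _ _) (hwin _ _) (hwin _ _)
          (hinjθ _ _ h1) (hinjθ _ _ h2)⟩)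
    (by
      rintro ⟨⟨d, hd⟩, ⟨j, hj⟩⟩ ⟨⟨d', hd'⟩, ⟨j', hj'⟩⟩ h1 h2
      simp only [k, l, Fin.mk.injEq] at h1 h2
      obtain rfl : d' = d := by omega
      obtain rfl : j' = j := by omega
      rfl)
  -- The sum of `2 * n - d` over `d` from 1 to `n` is `2 * n ^ 2 - (n + 1).choose 2`.
  have hcard : Fintype.card ι = 3 * n.choose 2 + n := by
    have h1 := sum_range_sub_add_choose (show n ≤ 2 * n by omega)
    have h2 : Fintype.card ι = ∑ d ∈ Finset.range n, (2 * n - (d + 1)) := by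
      rw [Fintype.card_sigma, ← Fin.sum_univ_eq_sum_range (fun d => 2 * n - (d + 1))]
      simp
    have h3 : (n + 1).choose 2 = n + n.choose 2 := by
      rw [Nat.choose_succ_succ' n 1, Nat.choose_one_right]
    have h5 : (n + 1).choose 2 * 2 = (n + 1) * n := by
      rw [Nat.choose_two_right, Nat.add_sub_cancel]
      exact Nat.div_mul_cancel (Nat.even_mul_pred_self (n + 1)).two_dvd
    rw [h2]
    nlinarith
  rwa [hcard] at key

theorem mainTheorem5 :
    IsGreatest {k : ℕ | ∃ S T : Set Plane, IsConstrainedL S ∧ IsConstrainedL T ∧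
      (S ∩ T).Finite ∧ (S ∩ T).ncard = k} 3 ∧
    ∀ n : ℕ,
      IsGreatest {R : ℕ∞ | ∃ S : Fin n → Set Plane, (∀ i, IsConstrainedL (S i)) ∧
        regionCount S = R} ((3 * n.choose 2 + n + 1 : ℕ) : ℕ∞) ∧
      ((3 * n.choose 2 + n + 1 : ℕ) : ℝ) = (3 * (n : ℝ) ^ 2 - n + 2) / 2 ∧
      ∀ (O : Plane) (r α : ℝ), 0 < r →
        (∀ i : Fin n, IsConstrainedL (squareCorner O r α n i)) ∧
        regionCount (fun i : Fin n => squareCorner O r α n i) =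
          ((3 * n.choose 2 + n + 1 : ℕ) : ℕ∞) := by
  refine ⟨⟨exists_inter_ncard_eq_three, ?_⟩, fun n => ?_⟩
  · rintro _ ⟨S, T, hS, hT, hfin, rfl⟩
    exact hS.ncard_inter_le hT hfin
  · have hsq : ∀ (O : Plane) (r α : ℝ), 0 < r →
        (∀ i : Fin n, IsConstrainedL (squareCorner O r α n i)) ∧
        regionCount (fun i : Fin n => squareCorner O r α n i) =
          ((3 * n.choose 2 + n + 1 : ℕ) : ℕ∞) := by
      intro O r α hr
      have hL : ∀ i : Fin n, IsConstrainedL (squareCorner O r α n i) :=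
        fun i => isConstrainedL_squareCorner O hr α i.pos i
      exact ⟨hL, le_antisymm (regionCount_le hL) (le_regionCount_squareCorner O hr α n)⟩
    refine ⟨⟨⟨_, hsq 0 1 0 one_pos⟩, ?_⟩, ?_, hsq⟩
    · rintro _ ⟨S, hS, rfl⟩
      exact regionCount_le hS
    · push_cast
      rw [Nat.cast_choose_two]
      ring
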